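/- \textbf{Setting.} All manifolds are smooth, finite-dimensional, Hausdorff and second countable. Let $M$ be a connected manifold with a smooth right action of a connected Lie group $H$, let $K<H$ be a closed connected subgroup, and let $\pi_H\colon M\to M/H$ and $\pi_K\colon M\to M/K$ be principal $H$- and $K$-bundles, i.e. surjective smooth submersions such that $H$, respectively $K$, acts freely and transitively on their fibres. Let $g$ be an $H$-invariant Riemannian metric on $M$ such that the bilinear form $(\xi,\eta)\mapsto g_m(\sigma_m(\xi),\sigma_m(\eta))$ on the Lie algebra $\mathfrak h$ of $H$ does not depend on $m\in M$, where $\sigma_m(\xi)=\frac{d}{dt}\big|_{t=0}m.\exp(t\xi)$. Put $\mathscr D_H=(\ker d\pi_H)^{\perp}$ and $\mathscr D_K=(\ker d\pi_K)^{\perp}$, let $g_{\mathscr D_H}$ be the restriction of $g$ to $\mathscr D_H$, let $\mathscr D=d\pi_K(\mathscr D_H)\subset T(M/K)$, and let $g_{\mathscr D}$ be the restriction to $\mathscr D$ of the metric $g_{M/K}$ on $M/K$ defined by $g_{M/K}(d_m\pi_K v,d_m\pi_K w)=g(v,w)$ for $m\in M$ and $v,w\in\mathscr D_K$ at $m$.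 For a distribution $D$ on a manifold $N$ with a metric $g_D$ on $D$, and $\lambda\in T_x^*N$, let $\sharp\lambda\in D_x$ be the vector with $\lambda(w)=g_D(\sharp\lambda,w)$ for all $w\in D_x$, let $\mathbf H^D(x,\lambda)=\frac12 g_D(\sharp\lambda,\sharp\lambda)$, and let $\overrightarrow{\mathbf H}^D$ be its Hamiltonian vector field on $T^*N$ with respect to the canonical symplectic form $\omega_N$, i.e. $\omega_N(\overrightarrow{\mathbf H}^D,w)=d\mathbf H^D(w)$. The \emph{sub-Riemannian geodesic of $(N,D,g_D)$ with initial data $(x,\lambda)$}, on an open interval $J\ni 0$, is the projection to $N$ of the integral curve of $\overrightarrow{\mathbf H}^D$ on $J$ that starts at $(x,\lambda)$ at time $0$. \textbf{Theorem.} Let $(n,\mu)\in T^*(M/K)$, let $m\in M$ with $\pi_K(m)=n$, and let $\lambda=\pi_K^*\mu=\mu\circ d_m\pi_K\in T^*_mM$. Suppose that $\pi_K^*\colon T^*(M/K)\to T^*M$ is symplectic near $(n,\mu)$, in the following sense: there are an open neighbourhood $U$ of $(n,\mu)$ and a smooth map $\Phi\colon U\to T^*M$ that sends every $(n',\mu')\in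 U$ to $(m',\mu'\circ d_{m'}\pi_K)$ for some $m'\in\pi_K^{-1}(n')$, and that satisfies $\omega_{M/K}(\alpha,\beta)=\omega_M(d\Phi(\alpha),d\Phi(\beta))$ for all tangent vectors $\alpha,\beta$ of $T^*(M/K)$ at a point of $U$. (This is so, in particular, if $\pi_K^*$ is a globally defined symplectomorphism.) Then: (1) the sub-Riemannian geodesic $\gamma_{\mathscr D_H}(t)$ of $(M,\mathscr D_H,g_{\mathscr D_H})$ with initial data $(m,\lambda)$ exists on $(-\varepsilon,\varepsilon)$ for some $\varepsilon>0$; (2) whenever it exists on an open interval $J\ni 0$, the curve $\pi_K\circ\gamma_{\mathscr D_H}$ is on $J$ the sub-Riemannian geodesic $\gamma_{\mathscr D}$ of $(M/K,\mathscr D,g_{\mathscr D})$ with initial data $(n,\mu)$, and that geodesic is unique on $J$; that is, $$\pi_K\big(\gamma_{\mathscr D_H}(t;m,\lambda)\big)=\gamma_{\mathscr D}(t;n,\mu)\qquad(t\in J).$$ -/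

import Mathlib

open Bundle Set Topology
open scoped Manifold ContDiff

noncomputable section

namespace SubRiem

/-! ### The cotangent bundle and its canonical symplectic form -/

section Cotangent

variable (E : Type*) [NormedAddCommGroup E] [NormedSpace ℝ E]
  (M : Type*) [TopologicalSpace M] [ChartedSpace E M] [IsManifold 𝓘(ℝ, E) ∞ M]

/-- The cotangent bundle `T*M`: the bundle of continuous linear forms on the tangent spaces, with
the manifold structure of a vector bundle. -/
abbrev CotangentBundle : Type _ :=
  TotalSpace (E →L[ℝ] ℝ) (fun x : M => TangentSpace 𝓘(ℝ, E) x →L[ℝ] Trivial M ℝ x)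

/-- The model of the manifold `T*M`. -/
abbrev cotModel : ModelWithCorners ℝ (E × (E →L[ℝ] ℝ)) (ModelProd E (E →L[ℝ] ℝ)) :=
  𝓘(ℝ, E).prod 𝓘(ℝ, E →L[ℝ] ℝ)

variable {E M}

/-- The tautological one-form on `T*M`: `θ_(x,λ) (w) = λ (dΠ w)`, with `Π : T*M → M` the
projection. -/
def tautologicalForm (p : CotangentBundle E M) : TangentSpace (cotModel E) p →L[ℝ] ℝ :=
  ContinuousLinearMap.comp (show TangentSpace 𝓘(ℝ, E) p.proj →L[ℝ] ℝ from p.2)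
    (mfderiv (cotModel E) 𝓘(ℝ, E) (TotalSpace.proj : CotangentBundle E M → M) p)

/-- The tautological one-form read in the preferred chart of `T*M` at `p`, that is, its pull-back
under the inverse of that chart. -/
def tautologicalFormInChart (p : CotangentBundle E M) (z : E × (E →L[ℝ] ℝ)) :
    E × (E →L[ℝ] ℝ) →L[ℝ] ℝ :=
  ContinuousLinearMap.comp (tautologicalForm ((extChartAt (cotModel E) p).symm z))
    (mfderiv 𝓘(ℝ, E × (E →L[ℝ] ℝ)) (cotModel E) (extChartAt (cotModel E) p).symm z)

/-- The canonical symplectic form `ω = -dθ` on `T*M` (so `ω = ∑ dqⁱ ∧ dpᵢ`), where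
`dθ (u, v) = (D_u θ) v - (D_v θ) u` is computed in the preferred chart at the point. -/
def canonicalSymplecticForm (p : CotangentBundle E M) (u v : TangentSpace (cotModel E) p) : ℝ :=
  let φ := extChartAt (cotModel E) p
  let dφ : TangentSpace (cotModel E) p →L[ℝ] E × (E →L[ℝ] ℝ) :=
    mfderiv (cotModel E) 𝓘(ℝ, E × (E →L[ℝ] ℝ)) φ p
  let Dθ := fderiv ℝ (tautologicalFormInChart p) (φ p)
  Dθ (dφ v) (dφ u) - Dθ (dφ u) (dφ v)

/-- The Hamiltonian vector field of `H : T*M → ℝ`: the vector field `X` that satisfies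
`ω (X, w) = dH (w)` for all `w`. -/
def hamiltonianVectorField (H : CotangentBundle E M → ℝ) (p : CotangentBundle E M) :
    TangentSpace (cotModel E) p :=
  Classical.epsilon fun X : TangentSpace (cotModel E) p =>
    ∀ w : TangentSpace (cotModel E) p,
      canonicalSymplecticForm p X w = mfderiv (cotModel E) 𝓘(ℝ, ℝ) H p w

/-! ### Sub-Riemannian Hamiltonians and geodesics -/

/-- The sharp map of a metric `gD` on a distribution `D` (given as a subset of `TM`): the vector
`X ∈ D_x` with `lam w = gD (X, w)` for all `w ∈ D_x`. Only the values of `gD` on `D` matter. -/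
def sharp (D : Set (TangentBundle 𝓘(ℝ, E) M))
    (gD : ∀ x : M, TangentSpace 𝓘(ℝ, E) x → TangentSpace 𝓘(ℝ, E) x → ℝ)
    (x : M) (lam : TangentSpace 𝓘(ℝ, E) x →L[ℝ] ℝ) : TangentSpace 𝓘(ℝ, E) x :=
  Classical.epsilon fun X : TangentSpace 𝓘(ℝ, E) x =>
    (⟨x, X⟩ : TangentBundle 𝓘(ℝ, E) M) ∈ D ∧
      ∀ w : TangentSpace 𝓘(ℝ, E) x, (⟨x, w⟩ : TangentBundle 𝓘(ℝ, E) M) ∈ D → lam w = gD x X w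

/-- The Hamiltonian `H (x, lam) = 1/2 gD (♯lam, ♯lam)` of the cometric associated to `gD`. -/
def hamiltonian (D : Set (TangentBundle 𝓘(ℝ, E) M))
    (gD : ∀ x : M, TangentSpace 𝓘(ℝ, E) x → TangentSpace 𝓘(ℝ, E) x → ℝ)
    (p : CotangentBundle E M) : ℝ :=
  (1 / 2) * gD p.proj (sharp D gD p.proj p.2) (sharp D gD p.proj p.2)

/-- `γ` is on `J` the sub-Riemannian geodesic of `(M, D, gD)` with initial data `p ∈ T*M`: it is
the projection to `M` of the integral curve on `J` of the Hamiltonian vector field of `(D, gD)`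
that starts at `p` at time `0`. -/
def IsSRGeodesicOn (D : Set (TangentBundle 𝓘(ℝ, E) M))
    (gD : ∀ x : M, TangentSpace 𝓘(ℝ, E) x → TangentSpace 𝓘(ℝ, E) x → ℝ)
    (p : CotangentBundle E M) (γ : ℝ → M) (J : Set ℝ) : Prop :=
  ∃ Γ : ℝ → CotangentBundle E M, Γ 0 = p ∧
    IsMIntegralCurveOn (I := cotModel E) Γ (hamiltonianVectorField (hamiltonian D gD)) J ∧
    ∀ t ∈ J, γ t = (Γ t).proj

end Cotangent

/-! ### Pull-back of covectors -/

section Pullback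

variable {E : Type*} [NormedAddCommGroup E] [NormedSpace ℝ E]
  {M : Type*} [TopologicalSpace M] [ChartedSpace E M] [IsManifold 𝓘(ℝ, E) ∞ M]
  {F : Type*} [NormedAddCommGroup F] [NormedSpace ℝ F]
  {N : Type*} [TopologicalSpace N] [ChartedSpace F N] [IsManifold 𝓘(ℝ, F) ∞ N]

/-- The pull-back `(m, pr^* μ)`, `pr^* μ = μ ∘ d_m pr`, of a covector `μ` at `pr m`. -/
def cotangentPullback (pr : M → N) (m : M) (μ : TangentSpace 𝓘(ℝ, F) (pr m) →L[ℝ] ℝ) :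
    CotangentBundle E M :=
  ⟨m, μ.comp (mfderiv 𝓘(ℝ, E) 𝓘(ℝ, F) pr m)⟩

/-- `Φ` is on `U` a smooth branch of the pull-back `pr^* : T*N → T*M`: a smooth map that sends
`(n, μ)` to `(m, pr^* μ)` for some `m` with `pr m = n`. -/
def IsPullbackBranchOn (pr : M → N) (Φ : CotangentBundle F N → CotangentBundle E M)
    (U : Set (CotangentBundle F N)) : Prop :=
  ContMDiffOn (cotModel F) (cotModel E) ∞ Φ U ∧
    ∀ q ∈ U, ∃ (m : M) (μ : TangentSpace 𝓘(ℝ, F) (pr m) →L[ℝ] ℝ),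
      q = ⟨pr m, μ⟩ ∧ Φ q = cotangentPullback pr m μ

/-- `Φ` preserves the canonical symplectic forms on `U`:
`ω_N (a, b) = ω_M (dΦ a, dΦ b)` at all points of `U`. -/
def PreservesSymplecticFormOn (Φ : CotangentBundle F N → CotangentBundle E M)
    (U : Set (CotangentBundle F N)) : Prop :=
  ∀ q ∈ U, ∀ a b : TangentSpace (cotModel F) q,
    canonicalSymplecticForm q a b =
      canonicalSymplecticForm (Φ q) (mfderiv (cotModel F) (cotModel E) Φ q a)
        (mfderiv (cotModel F) (cotModel E) Φ q b)

/-- The pull-back `pr^* : T*N → T*M` is symplectic near `q ∈ T*N`: it has a smooth branch on an open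
neighbourhood of `q` that preserves the canonical symplectic forms. -/
def PullbackIsSymplecticNear (E : Type*) [NormedAddCommGroup E] [NormedSpace ℝ E]
    [ChartedSpace E M] [IsManifold 𝓘(ℝ, E) ∞ M] (pr : M → N) (q : CotangentBundle F N) : Prop :=
  ∃ (U : Set (CotangentBundle F N)) (Φ : CotangentBundle F N → CotangentBundle E M),
    IsOpen U ∧ q ∈ U ∧ IsPullbackBranchOn pr Φ U ∧ PreservesSymplecticFormOn Φ U

end Pullback

/-! ### Principal bundles, metrics, and the induced structure on the base -/

section Principal

variable {E : Type*} [NormedAddCommGroup E] [NormedSpace ℝ E]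
  {M : Type*} [TopologicalSpace M] [ChartedSpace E M] [IsManifold 𝓘(ℝ, E) ∞ M]
  {F : Type*} [NormedAddCommGroup F] [NormedSpace ℝ F]
  {N : Type*} [TopologicalSpace N] [ChartedSpace F N] [IsManifold 𝓘(ℝ, F) ∞ N]
  {L : Type*} [NormedAddCommGroup L] [NormedSpace ℝ L]
  {H : Type*} [Group H] [TopologicalSpace H] [ChartedSpace L H]
  [MulAction (MulOpposite H) M]

/-- The right action `m.h`. -/
abbrev ract (m : M) (h : H) : M := MulOpposite.op h • m

/-- `pr : M → N` is a principal bundle for the action of the subgroup `K` of `H` (`K = ⊤` for `H`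
itself): a surjective smooth submersion such that `K` acts freely and transitively on its
fibres. -/
structure IsPrincipalBundle (E F : Type*) [NormedAddCommGroup E] [NormedSpace ℝ E]
    [NormedAddCommGroup F] [NormedSpace ℝ F] [ChartedSpace E M] [ChartedSpace F N]
    (K : Subgroup H) (pr : M → N) : Prop where
  isSubmersion : Manifold.IsSubmersion 𝓘(ℝ, E) 𝓘(ℝ, F) ∞ pr
  surjective : Function.Surjective pr
  free : ∀ (m : M), ∀ k ∈ K, ract m k = m → k = 1
  fibre : ∀ m m' : M, pr m = pr m' ↔ ∃ k ∈ K, m' = ract m k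

/-- A smooth Riemannian metric on `M`. -/
abbrev Metric (E : Type*) [NormedAddCommGroup E] [NormedSpace ℝ E]
    (M : Type*) [TopologicalSpace M] [ChartedSpace E M] [IsManifold 𝓘(ℝ, E) ∞ M] :=
  ContMDiffRiemannianMetric 𝓘(ℝ, E) ∞ E (fun x : M => TangentSpace 𝓘(ℝ, E) x)

/-- The value at `m` of the fundamental vector field of `ξ` in the Lie algebra `T_1 H`: the image
of `ξ` under the differential at `1` of the orbit map `h ↦ m.h` (which is the velocity at `t = 0`
of `m.exp (t ξ)`). -/
def fundamentalField (E : Type*) [NormedAddCommGroup E] [NormedSpace ℝ E] [ChartedSpace E M]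
    (m : M) (ξ : TangentSpace 𝓘(ℝ, L) (1 : H)) :
    TangentSpace 𝓘(ℝ, E) (ract m (1 : H)) :=
  mfderiv 𝓘(ℝ, L) 𝓘(ℝ, E) (fun h : H => ract m h) 1 ξ

variable (L H) in
/-- The metric `g` is invariant under the right action of `H`, and the bilinear form
`(ξ, η) ↦ g_m (σ_m ξ, σ_m η)` on the Lie algebra of `H` does not depend on `m`. -/
structure IsConstantBiInvariantType (g : Metric E M) : Prop where
  invariant : ∀ (h : H) (m : M) (v w : TangentSpace 𝓘(ℝ, E) m),
    g.inner (ract m h) (mfderiv 𝓘(ℝ, E) 𝓘(ℝ, E) (fun x : M => ract x h) m v)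
      (mfderiv 𝓘(ℝ, E) 𝓘(ℝ, E) (fun x : M => ract x h) m w) = g.inner m v w
  constant : ∀ (m m' : M) (ξ η : TangentSpace 𝓘(ℝ, L) (1 : H)),
    g.inner (ract m (1 : H)) (fundamentalField E m ξ) (fundamentalField E m η) =
      g.inner (ract m' (1 : H)) (fundamentalField E m' ξ) (fundamentalField E m' η)

/-- The Ehresmann connection of `pr` orthogonal to the vertical bundle: all tangent vectors that
are `g`-orthogonal to `ker dpr`. -/
def horizontal (g : Metric E M) (pr : M → N) : Set (TangentBundle 𝓘(ℝ, E) M) :=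
  {p | ∀ w : TangentSpace 𝓘(ℝ, E) p.proj,
    mfderiv 𝓘(ℝ, E) 𝓘(ℝ, F) pr p.proj w = 0 → g.inner p.proj p.2 w = 0}

/-- The image `dpr (D)` in `TN` of a distribution `D` on `M`. -/
def pushDistribution (pr : M → N) (D : Set (TangentBundle 𝓘(ℝ, E) M)) :
    Set (TangentBundle 𝓘(ℝ, F) N) :=
  tangentMap 𝓘(ℝ, E) 𝓘(ℝ, F) pr '' D

/-- The metric on `N` defined by `g (v, w) = g_N (d_m pr v, d_m pr w)` for all `m` over `n` and all
horizontal `v, w` at `m`. -/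
def baseMetric (g : Metric E M) (pr : M → N) (n : N) (v' w' : TangentSpace 𝓘(ℝ, F) n) : ℝ :=
  Classical.epsilon fun r : ℝ => ∀ (m : M) (v w : TangentSpace 𝓘(ℝ, E) m),
    (⟨m, v⟩ : TangentBundle 𝓘(ℝ, E) M) ∈ horizontal (F := F) g pr →
    (⟨m, w⟩ : TangentBundle 𝓘(ℝ, E) M) ∈ horizontal (F := F) g pr →
    tangentMap 𝓘(ℝ, E) 𝓘(ℝ, F) pr ⟨m, v⟩ = (⟨n, v'⟩ : TangentBundle 𝓘(ℝ, F) N) →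
    tangentMap 𝓘(ℝ, E) 𝓘(ℝ, F) pr ⟨m, w⟩ = (⟨n, w'⟩ : TangentBundle 𝓘(ℝ, F) N) →
    g.inner m v w = r

end Principal

end SubRiem

end

/-! Write `pr` for `π_K`. The covectors `μ ∘ d pr` form the annihilator `W` of `ker d pr` in `T*M`,
and `μ ∘ d pr ↦ μ` maps `W` to `T*(M/K)`. On `W` the Hamiltonian `h` of `(D_H, g)` is the pull-back
of the Hamiltonian `k` of `(D, g_D)`. Indeed `K`-orbits lie in `H`-orbits, so `D_H ⊂ D_K`. There `d
pr` is isometric for the base metric, hence it carries the sharp of `μ ∘ d pr` to the sharp of `μ`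
(`hamiltonian_cotangentPullback`). Translations by `K` are isometries that preserve the fibres of
both projections: they make the base metric well defined and allow vectors of `D` to be lifted to
any prescribed point of the fibre.

The identity `h = k` along `W` forces the Hamiltonian field of `h` to be tangent to `W` and to
project to that of `k`. If `pr` reads `f` in charts, `W` is parametrized by `(x, ν) ↦ (x, ν ∘
Df(x))`. Differentiating `h(x, ν ∘ Df(x)) = k(f(x), ν)` and using the symmetry of `D²f` relates the
two fields (`symplecticGradient_related`), so that one curve `(x(t), ν(t))` produces solutions of
both Hamiltonian systems (`exists_hamilton_lift`). The abstract Hamiltonian fields become these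
coordinate gradients because the charts of `T*M` are symplectic
(`cotChartDeriv_hamiltonianVectorField`).

To pass from local to global, an integral curve of `h` that meets `W` stays in `W` for a while by
uniqueness, and for all of `J` because `W` is closed and `J` is connected
(`exists_isMIntegralCurveOn_proj`). Uniqueness needs smooth Hamiltonians: for `h` this follows from
an explicit formula for the sharp map (`contDiffAt_orthogonalSharp`), for `k` from local sections of
`pr` (`contMDiff_of_cotangentPullback`). -/

noncomputable section

namespace SubRiem

set_option linter.unusedSectionVars false

/-! ### Hamiltonian calculus on `E × E*` -/

section Calculus

set_option synthInstance.maxHeartbeats 400000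

variable {E F : Type*} [NormedAddCommGroup E] [NormedSpace ℝ E]
  [NormedAddCommGroup F] [NormedSpace ℝ F]

/-- A map that preserves the tautological one-form `∑ pᵢ dqⁱ` preserves its differential. -/
theorem symplectic_of_preserves_tautological {τ : E × (E →L[ℝ] ℝ) → F × (F →L[ℝ] ℝ)}
    {z₀ : E × (E →L[ℝ] ℝ)} (hτ : ContDiffAt ℝ 2 τ z₀)
    (h : ∀ᶠ z in 𝓝 z₀, ∀ w, (τ z).2 ((fderiv ℝ τ z w).1) = z.2 w.1) (u w : E × (E →L[ℝ] ℝ)) :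
    (fderiv ℝ τ z₀ w).2 (fderiv ℝ τ z₀ u).1 - (fderiv ℝ τ z₀ u).2 (fderiv ℝ τ z₀ w).1 =
      w.2 u.1 - u.2 w.1 := by
  have hd : HasFDerivAt τ (fderiv ℝ τ z₀) z₀ := (hτ.differentiableAt (by simp)).hasFDerivAt
  have hdd : HasFDerivAt (fderiv ℝ τ) (fderiv ℝ (fderiv ℝ τ) z₀) z₀ :=
    ((hτ.fderiv_right (m := 1) (by norm_num)).differentiableAt (by simp)).hasFDerivAt
  have hsymm := (hτ.isSymmSndFDerivAt (by simp)) u w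
  -- The derivative of the hypothesis for `w` in direction `u`. Its second-order term is symmetric
  -- in `u` and `w`, so it cancels when the identity with `u` and `w` exchanged is subtracted.
  have key : ∀ u w : E × (E →L[ℝ] ℝ), (fderiv ℝ τ z₀ u).2 (fderiv ℝ τ z₀ w).1 +
      (τ z₀).2 (fderiv ℝ (fderiv ℝ τ) z₀ u w).1 = u.2 w.1 := by
    intro u w
    have h1 : HasFDerivAt (fun z => (τ z).2 ((fderiv ℝ τ z w).1)) _ z₀ :=
      hd.snd.clm_apply ((hdd.clm_apply (hasFDerivAt_const w z₀)).fst)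
    have h2 : HasFDerivAt (fun z : E × (E →L[ℝ] ℝ) => z.2 w.1) _ z₀ :=
      (hasFDerivAt_snd).clm_apply (hasFDerivAt_const w.1 z₀)
    have h3 := (h1.congr_of_eventuallyEq
      (show (fun z : E × (E →L[ℝ] ℝ) => z.2 w.1) =ᶠ[𝓝 z₀] _ by
        filter_upwards [h] with z hz using (hz w).symm)).unique h2
    have h4 := DFunLike.congr_fun h3 u
    simp at h4
    linarith
  have h1 := key u w
  have h2 := key w u
  rw [hsymm] at h1
  linarith

section symplecticGradient

variable [FiniteDimensional ℝ E] [FiniteDimensional ℝ F]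

/-- The canonical symplectic form on `E × E*`, as a linear map to the dual. -/
def canonicalMap (E : Type*) [NormedAddCommGroup E] [NormedSpace ℝ E] :
    (E × (E →L[ℝ] ℝ)) →ₗ[ℝ] ((E × (E →L[ℝ] ℝ)) →L[ℝ] ℝ) where
  toFun X := (ContinuousLinearMap.apply ℝ ℝ X.1).comp
    (ContinuousLinearMap.snd ℝ E (E →L[ℝ] ℝ)) - X.2.comp (ContinuousLinearMap.fst ℝ E _)
  map_add' X Y := ContinuousLinearMap.ext fun w => by simp; ring
  map_smul' c X := ContinuousLinearMap.ext fun w => by simp; ring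

theorem canonicalMap_apply {E : Type*} [NormedAddCommGroup E] [NormedSpace ℝ E]
    (X w : E × (E →L[ℝ] ℝ)) : canonicalMap E X w = w.2 X.1 - X.2 w.1 := rfl

/-- Nondegeneracy of the canonical form: the vectors `(0, σ)` detect the first component of `X`,
since the dual separates points, and the vectors `(u, 0)` detect the second. -/
theorem canonicalMap_injective (E : Type*) [NormedAddCommGroup E] [NormedSpace ℝ E] :
    Function.Injective (canonicalMap E) := by
  rw [injective_iff_map_eq_zero]
  intro X hX
  have hX' (w : E × (E →L[ℝ] ℝ)) : w.2 X.1 - X.2 w.1 = 0 := by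
    rw [← canonicalMap_apply, hX, zero_apply]
  refine Prod.ext ?_ ?_
  · by_contra hne
    obtain ⟨σ, hσ⟩ := SeparatingDual.exists_ne_zero (R := ℝ) hne
    exact hσ (by simpa using hX' (0, σ))
  · ext u
    simpa using hX' (u, 0)

theorem finrank_continuousDual (V : Type*) [NormedAddCommGroup V] [NormedSpace ℝ V]
    [FiniteDimensional ℝ V] : Module.finrank ℝ V = Module.finrank ℝ (V →L[ℝ] ℝ) := by
  rw [← (LinearMap.toContinuousLinearMap (𝕜 := ℝ) (E := V) (F' := ℝ)).finrank_eq,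
    Module.finrank_linearMap_self]

/-- The isomorphism of `E × E*` with its dual given by the canonical symplectic form. -/
def canonicalEquiv (E : Type*) [NormedAddCommGroup E] [NormedSpace ℝ E] [FiniteDimensional ℝ E] :
    (E × (E →L[ℝ] ℝ)) ≃L[ℝ] ((E × (E →L[ℝ] ℝ)) →L[ℝ] ℝ) :=
  (LinearEquiv.ofInjectiveOfFinrankEq (canonicalMap E) (canonicalMap_injective E)
    (finrank_continuousDual _)).toContinuousLinearEquiv

theorem canonicalEquiv_apply (X w : E × (E →L[ℝ] ℝ)) :
    canonicalEquiv E X w = w.2 X.1 - X.2 w.1 := rfl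

/-- The symplectic gradient of a function on `E × E*`. -/
def symplecticGradient (h : E × (E →L[ℝ] ℝ) → ℝ) (z : E × (E →L[ℝ] ℝ)) : E × (E →L[ℝ] ℝ) :=
  (canonicalEquiv E).symm (fderiv ℝ h z)

theorem symplecticGradient_spec (h : E × (E →L[ℝ] ℝ) → ℝ) (z w : E × (E →L[ℝ] ℝ)) :
    w.2 (symplecticGradient h z).1 - (symplecticGradient h z).2 w.1 = fderiv ℝ h z w := by
  rw [← canonicalEquiv_apply, symplecticGradient, ContinuousLinearEquiv.apply_symm_apply]

theorem eq_symplecticGradient {h : E × (E →L[ℝ] ℝ) → ℝ} {z X : E × (E →L[ℝ] ℝ)}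
    (hX : ∀ w : E × (E →L[ℝ] ℝ), w.2 X.1 - X.2 w.1 = fderiv ℝ h z w) :
    X = symplecticGradient h z := by
  rw [symplecticGradient, ContinuousLinearEquiv.eq_symm_apply]
  exact ContinuousLinearMap.ext fun w => by rw [canonicalEquiv_apply, hX]

/-- One derivative is lost, so `C²` Hamiltonians have `C¹` gradients, which suffices for existence
and local uniqueness of solutions. -/
theorem contDiffAt_symplecticGradient {h : E × (E →L[ℝ] ℝ) → ℝ} {z : E × (E →L[ℝ] ℝ)}
    (hh : ContDiffAt ℝ 2 h z) : ContDiffAt ℝ 1 (symplecticGradient h) z := by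
  have h1 : ContDiffAt ℝ 1 (fderiv ℝ h) z := hh.fderiv_right (m := 1) (by norm_num)
  exact h1.continuousLinearMap_comp (canonicalEquiv E).symm.toContinuousLinearMap

/-- Solutions of Hamilton's equations are locally unique. -/
theorem hamilton_unique {h : E × (E →L[ℝ] ℝ) → ℝ} {z z' : ℝ → E × (E →L[ℝ] ℝ)} {t₀ : ℝ}
    (hh : ContDiffAt ℝ 2 h (z t₀)) (h0 : z t₀ = z' t₀)
    (hz : ∀ᶠ t in 𝓝 t₀, HasDerivAt z (symplecticGradient h (z t)) t)
    (hz' : ∀ᶠ t in 𝓝 t₀, HasDerivAt z' (symplecticGradient h (z' t)) t) : z =ᶠ[𝓝 t₀] z' := by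
  -- A `C¹` field is Lipschitz on a neighbourhood `s` of the initial point, and by continuity both
  -- curves remain in `s` for times near `t₀`.
  obtain ⟨C, s, hs, hlip⟩ := (contDiffAt_symplecticGradient hh).exists_lipschitzOnWith
  exact ODE_solution_unique_of_eventually (v := fun _ => symplecticGradient h) (s := fun _ => s)
    (Filter.Eventually.of_forall fun _ => hlip)
    (hz.and (hz.self_of_nhds.continuousAt hs)) (hz'.and (hz'.self_of_nhds.continuousAt (h0 ▸ hs))) h0

variable {f : E → F} {h : E × (E →L[ℝ] ℝ) → ℝ} {k : F × (F →L[ℝ] ℝ) → ℝ}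

/-- The symplectic gradients of two functions that correspond to each other under the pull-back of
covectors by `f`. -/
theorem symplecticGradient_related {x : E} {ν : F →L[ℝ] ℝ} (hf : ContDiffAt ℝ 2 f x)
    (hh : DifferentiableAt ℝ h (x, ν.comp (fderiv ℝ f x))) (hk : DifferentiableAt ℝ k (f x, ν))
    (hrel : ∀ᶠ z : E × (F →L[ℝ] ℝ) in 𝓝 (x, ν), h (z.1, z.2.comp (fderiv ℝ f z.1)) = k (f z.1, z.2)) :
    fderiv ℝ f x (symplecticGradient h (x, ν.comp (fderiv ℝ f x))).1 =
        (symplecticGradient k (f x, ν)).1 ∧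
      (symplecticGradient h (x, ν.comp (fderiv ℝ f x))).2 =
        (symplecticGradient k (f x, ν)).2.comp (fderiv ℝ f x) + ν.comp (fderiv ℝ (fderiv ℝ f) x
          (symplecticGradient h (x, ν.comp (fderiv ℝ f x))).1) := by
  set X := symplecticGradient h (x, ν.comp (fderiv ℝ f x)) with hX
  set Y := symplecticGradient k (f x, ν) with hY
  have hd : HasFDerivAt f (fderiv ℝ f x) x := (hf.differentiableAt (by simp)).hasFDerivAt
  have hdd : HasFDerivAt (fderiv ℝ f) (fderiv ℝ (fderiv ℝ f) x) x :=
    ((hf.fderiv_right (m := 1) (by norm_num)).differentiableAt (by simp)).hasFDerivAt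
  have hsymm := hf.isSymmSndFDerivAt (by simp)
  have e1 : HasFDerivAt (fun z : E × (F →L[ℝ] ℝ) => (z.1, z.2.comp (fderiv ℝ f z.1))) _ (x, ν) :=
    hasFDerivAt_fst.prodMk
      (hasFDerivAt_snd.clm_comp (HasFDerivAt.comp (x, ν) (g := fderiv ℝ f) hdd hasFDerivAt_fst))
  have e2 : HasFDerivAt (fun z : E × (F →L[ℝ] ℝ) => (f z.1, z.2)) _ (x, ν) :=
    (HasFDerivAt.comp (x, ν) (g := f) hd hasFDerivAt_fst).prodMk hasFDerivAt_snd
  have e3 := HasFDerivAt.comp (x, ν) (g := h) hh.hasFDerivAt e1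
  have e4 := HasFDerivAt.comp (x, ν) (g := k) hk.hasFDerivAt e2
  have e5 := (e3.congr_of_eventuallyEq (hrel.mono fun z hz => hz.symm)).unique e4
  -- The differential of the identity `h(x, ν ∘ Df(x)) = k(f(x), ν)` in direction `(u, η)`, with
  -- `dh` and `dk` expressed by the symplectic gradients `X` and `Y`. Taking `u = 0` gives the first
  -- claim; taking `η = 0`, together with the symmetry of `D²f`, gives the second.
  have e6 : ∀ (u : E) (η : F →L[ℝ] ℝ),
      η (fderiv ℝ f x X.1) + ν (fderiv ℝ (fderiv ℝ f) x u X.1) - X.2 u =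
        η Y.1 - Y.2 (fderiv ℝ f x u) := by
    intro u η
    have := DFunLike.congr_fun e5 (u, η)
    simp only [ContinuousLinearMap.comp_apply] at this
    rw [← symplecticGradient_spec, ← symplecticGradient_spec, ← hX, ← hY] at this
    simp at this
    linarith
  constructor
  · by_contra hne
    obtain ⟨σ, hσ⟩ := SeparatingDual.exists_ne_zero (R := ℝ) (sub_ne_zero.2 hne)
    have := e6 0 σ
    simp at this
    exact hσ (by rw [map_sub, this, sub_self])
  · ext u
    have := e6 u 0
    rw [hsymm u X.1] at this
    simp at this ⊢
    linarith

/-- If `h` and `k` correspond to each other under the pull-back of covectors by `f`, then there is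
a solution of Hamilton's equations for `h` that starts at a given pulled back covector, stays pulled
back, and projects to a solution of Hamilton's equations for `k`. -/
theorem exists_hamilton_lift {x₀ : E} {ν₀ : F →L[ℝ] ℝ} (t₀ : ℝ) (hf : ContDiffAt ℝ 2 f x₀)
    (hh : ContDiffAt ℝ 2 h (x₀, ν₀.comp (fderiv ℝ f x₀))) (hk : ContDiffAt ℝ 2 k (f x₀, ν₀))
    (hrel : ∀ᶠ z : E × (F →L[ℝ] ℝ) in 𝓝 (x₀, ν₀),
      h (z.1, z.2.comp (fderiv ℝ f z.1)) = k (f z.1, z.2)) :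
    ∃ (x : ℝ → E) (ν : ℝ → F →L[ℝ] ℝ), x t₀ = x₀ ∧ ν t₀ = ν₀ ∧ ∀ᶠ t in 𝓝 t₀,
      HasDerivAt (fun t => (x t, (ν t).comp (fderiv ℝ f (x t))))
          (symplecticGradient h (x t, (ν t).comp (fderiv ℝ f (x t)))) t ∧
        HasDerivAt (fun t => (f (x t), ν t)) (symplecticGradient k (f (x t), ν t)) t := by
  have c1 : ContDiffAt ℝ 1 (fun z : E × (F →L[ℝ] ℝ) => (z.1, z.2.comp (fderiv ℝ f z.1)))
      (x₀, ν₀) := by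
    refine contDiffAt_fst.prodMk (contDiffAt_snd.clm_comp ?_)
    exact ContDiffAt.comp (x₀, ν₀) (g := fderiv ℝ f) (hf.fderiv_right (m := 1) (by norm_num))
      contDiffAt_fst
  have c2 : ContDiffAt ℝ 1 (fun z : E × (F →L[ℝ] ℝ) => (f z.1, z.2)) (x₀, ν₀) :=
    (ContDiffAt.comp (x₀, ν₀) (g := f) (hf.of_le (by norm_num)) contDiffAt_fst).prodMk contDiffAt_snd
  -- A field on the parameter space `E × F*` of pulled back covectors: the position moves as for
  -- `h`, the covector as for `k`. By `symplecticGradient_related` both images of its integral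
  -- curves satisfy Hamilton's equations.
  let V : E × (F →L[ℝ] ℝ) → E × (F →L[ℝ] ℝ) := fun z =>
    ((symplecticGradient h (z.1, z.2.comp (fderiv ℝ f z.1))).1, (symplecticGradient k (f z.1, z.2)).2)
  have cV : ContDiffAt ℝ 1 V (x₀, ν₀) :=
    (ContDiffAt.comp (x₀, ν₀) (g := symplecticGradient h) (contDiffAt_symplecticGradient hh) c1).fst.prodMk
    (ContDiffAt.comp (x₀, ν₀) (g := symplecticGradient k) (contDiffAt_symplecticGradient hk) c2).snd
  obtain ⟨α, hα0, ε, hε, hα⟩ := cV.exists_forall_mem_closedBall_exists_eq_forall_mem_Ioo_hasDerivAt₀ t₀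
  replace hα : ∀ᶠ t in 𝓝 t₀, HasDerivAt α (V (α t)) t :=
    Filter.mem_of_superset (Ioo_mem_nhds (by linarith) (by linarith)) hα
  have hcont : Filter.Tendsto α (𝓝 t₀) (𝓝 (x₀, ν₀)) := by
    have := hα.self_of_nhds.continuousAt
    rwa [ContinuousAt, hα0] at this
  refine ⟨fun t => (α t).1, fun t => (α t).2, by simp [hα0], by simp [hα0], ?_⟩
  have v1 : ∀ᶠ z : E × (F →L[ℝ] ℝ) in 𝓝 (x₀, ν₀), ContDiffAt ℝ 2 f z.1 :=
    continuousAt_fst.eventually (hf.eventually (by simp))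
  have v2 : ∀ᶠ z : E × (F →L[ℝ] ℝ) in 𝓝 (x₀, ν₀),
      DifferentiableAt ℝ h (z.1, z.2.comp (fderiv ℝ f z.1)) :=
    c1.continuousAt.eventually ((hh.eventually (by simp)).mono fun z hz =>
      hz.differentiableAt (by simp))
  have v3 : ∀ᶠ z : E × (F →L[ℝ] ℝ) in 𝓝 (x₀, ν₀), DifferentiableAt ℝ k (f z.1, z.2) :=
    c2.continuousAt.eventually ((hk.eventually (by simp)).mono fun z hz =>
      hz.differentiableAt (by simp))
  filter_upwards [hα, hcont.eventually v1, hcont.eventually v2, hcont.eventually v3,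
    hcont.eventually hrel.eventually_nhds] with t ht w1 w2 w3 w4
  obtain ⟨r1, r2⟩ := symplecticGradient_related w1 w2 w3 w4
  have d1 : HasDerivAt (fun t => (α t).1)
      (symplecticGradient h ((α t).1, (α t).2.comp (fderiv ℝ f (α t).1))).1 t := ht.fst
  have d2 : HasDerivAt (fun t => (α t).2) (symplecticGradient k (f (α t).1, (α t).2)).2 t := ht.snd
  have g1 : HasFDerivAt f (fderiv ℝ f (α t).1) (α t).1 :=
    (w1.differentiableAt (by simp)).hasFDerivAt
  have g2 : HasFDerivAt (fderiv ℝ f) (fderiv ℝ (fderiv ℝ f) (α t).1) (α t).1 :=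
    ((w1.fderiv_right (m := 1) (by norm_num)).differentiableAt (by simp)).hasFDerivAt
  constructor
  -- The product rule for `ν ∘ Df(x)` gives exactly the right-hand side of `r2`.
  · have e := d1.prodMk (d2.clm_comp (g2.comp_hasDerivAt t d1))
    exact e.congr_deriv (Prod.ext rfl r2.symm)
  · have e := (g1.comp_hasDerivAt t d1).prodMk d2
    exact e.congr_deriv (Prod.ext r1 rfl)

end symplecticGradient

end Calculus

/-! ### Charts of the cotangent bundle -/

section Charts

variable {E : Type*} [NormedAddCommGroup E] [NormedSpace ℝ E]
  {M : Type*} [TopologicalSpace M] [ChartedSpace E M] [IsManifold 𝓘(ℝ, E) ∞ M]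

/-- The differential at `x` of the preferred chart at `c`, as an endomorphism of the model. -/
def chartDeriv (E : Type*) [NormedAddCommGroup E] [NormedSpace ℝ E]
    {M : Type*} [TopologicalSpace M] [ChartedSpace E M] (c x : M) : E →L[ℝ] E :=
  mfderiv 𝓘(ℝ, E) 𝓘(ℝ, E) (extChartAt 𝓘(ℝ, E) c) x

/-- The differential at `y` of the inverse of the preferred chart at `c`, as an endomorphism of the
model. -/
def chartSymmDeriv {E : Type*} [NormedAddCommGroup E] [NormedSpace ℝ E]
    {M : Type*} [TopologicalSpace M] [ChartedSpace E M] (c : M) (y : E) : E →L[ℝ] E :=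
  mfderiv 𝓘(ℝ, E) 𝓘(ℝ, E) (extChartAt 𝓘(ℝ, E) c).symm y

/-- The coordinates on `T*M` that are induced by the preferred chart at `c`. -/
def cotCoord (c : M) (p : CotangentBundle E M) : E × (E →L[ℝ] ℝ) :=
  (extChartAt 𝓘(ℝ, E) c p.proj,
    (show E →L[ℝ] ℝ from p.2).comp (chartSymmDeriv c (extChartAt 𝓘(ℝ, E) c p.proj)))

/-- The inverse of the coordinates on `T*M` that are induced by the preferred chart at `c`. -/
def cotCoordSymm (c : M) (z : E × (E →L[ℝ] ℝ)) : CotangentBundle E M :=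
  ⟨(extChartAt 𝓘(ℝ, E) c).symm z.1,
    (show TangentSpace 𝓘(ℝ, E) ((extChartAt 𝓘(ℝ, E) c).symm z.1) →L[ℝ] ℝ from
      z.2.comp (chartDeriv E c ((extChartAt 𝓘(ℝ, E) c).symm z.1)))⟩

theorem chartDeriv_comp_chartSymmDeriv {c : M} {y : E} (hy : y ∈ (extChartAt 𝓘(ℝ, E) c).target) :
    (chartDeriv E c ((extChartAt 𝓘(ℝ, E) c).symm y)).comp (chartSymmDeriv c y) =
      ContinuousLinearMap.id ℝ E := by
  have := mfderiv_extChartAt_comp_mfderivWithin_extChartAt_symm (I := 𝓘(ℝ, E)) hy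
  simpa only [modelWithCornersSelf_coe, range_id, mfderivWithin_univ] using! this

theorem chartSymmDeriv_comp_chartDeriv {c : M} {y : E} (hy : y ∈ (extChartAt 𝓘(ℝ, E) c).target) :
    (chartSymmDeriv c y).comp (chartDeriv E c ((extChartAt 𝓘(ℝ, E) c).symm y)) =
      ContinuousLinearMap.id ℝ E := by
  have := mfderivWithin_extChartAt_symm_comp_mfderiv_extChartAt (I := 𝓘(ℝ, E)) hy
  simpa only [modelWithCornersSelf_coe, range_id, mfderivWithin_univ] using! this

/-- Identifies the chart of `T*M` as a bundle of homomorphisms with classical coordinates `(q, p)`.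
The inverse tangent trivialization is the differential of the inverse chart, and the trivial line
bundle contributes the identity. -/
theorem extChartAt_cotangent_apply (p : CotangentBundle E M) {y : CotangentBundle E M}
    (hy : y.proj ∈ (extChartAt 𝓘(ℝ, E) p.proj).source) :
    extChartAt (cotModel E) p y = cotCoord p.proj y := by
  rw [extChartAt_source] at hy
  have h1 := hom_chart (HB := E) (F₁ := E) (E₁ := fun x : M => TangentSpace 𝓘(ℝ, E) x) (F₂ := ℝ)
    (E₂ := Trivial M ℝ) (𝕜 := ℝ) p y
  have h2 := TangentBundle.symmL_trivializationAt (I := 𝓘(ℝ, E)) hy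
  simp only [modelWithCornersSelf_coe, range_id, mfderivWithin_univ] at h2
  have h3 := congrArg Prod.fst h1
  have h4 := congrArg Prod.snd h1
  refine Prod.ext h3 (Eq.trans h4 ?_)
  have h5 : (trivializationAt ℝ (Trivial M ℝ) p.proj).continuousLinearMapAt ℝ y.proj =
    ContinuousLinearMap.id ℝ ℝ := Trivial.continuousLinearMapAt_trivialization ℝ M ℝ y.proj
  exact congrArg₂ (fun (B : ℝ →L[ℝ] ℝ) (A : E →L[ℝ] E) =>
    B.comp ((show E →L[ℝ] ℝ from y.2).comp A)) h5 h2

theorem cotCoord_cotCoordSymm {c : M} {z : E × (E →L[ℝ] ℝ)}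
    (hz : z.1 ∈ (extChartAt 𝓘(ℝ, E) c).target) : cotCoord c (cotCoordSymm c z) = z := by
  refine Prod.ext ((extChartAt 𝓘(ℝ, E) c).right_inv hz) ?_
  change (z.2.comp (chartDeriv E c ((extChartAt 𝓘(ℝ, E) c).symm z.1))).comp
    (chartSymmDeriv c (extChartAt 𝓘(ℝ, E) c ((extChartAt 𝓘(ℝ, E) c).symm z.1))) = z.2
  rw [(extChartAt 𝓘(ℝ, E) c).right_inv hz, ContinuousLinearMap.comp_assoc,
    chartDeriv_comp_chartSymmDeriv hz, ContinuousLinearMap.comp_id]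

theorem extChartAt_cotangent_source (p : CotangentBundle E M) :
    (extChartAt (cotModel E) p).source = {y | y.proj ∈ (extChartAt 𝓘(ℝ, E) p.proj).source} := by
  ext y
  rw [FiberBundle.extChartAt]
  simp only [mfld_simps]
  exact ⟨fun h => h.1.1, fun h => ⟨⟨h, mem_univ _⟩, h⟩⟩

theorem extChartAt_cotangent_target (p : CotangentBundle E M) :
    (extChartAt (cotModel E) p).target = (extChartAt 𝓘(ℝ, E) p.proj).target ×ˢ univ := by
  rw [FiberBundle.extChartAt_target]
  congr 1
  refine inter_eq_left.2 fun z hz => ?_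
  have := (extChartAt 𝓘(ℝ, E) p.proj).map_target hz
  rw [extChartAt_source] at this
  simpa using this

theorem extChartAt_cotangent_symm_apply (p : CotangentBundle E M) {z : E × (E →L[ℝ] ℝ)}
    (hz : z.1 ∈ (extChartAt 𝓘(ℝ, E) p.proj).target) :
    (extChartAt (cotModel E) p).symm z = cotCoordSymm p.proj z := by
  have h1 : (cotCoordSymm p.proj z).proj ∈ (extChartAt 𝓘(ℝ, E) p.proj).source :=
    (extChartAt 𝓘(ℝ, E) p.proj).map_target hz
  have h2 : cotCoordSymm p.proj z ∈ (extChartAt (cotModel E) p).source := by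
    rw [extChartAt_cotangent_source]
    exact h1
  rw [← (extChartAt (cotModel E) p).left_inv h2, extChartAt_cotangent_apply p h1,
    cotCoord_cotCoordSymm hz]

end Charts

/-! ### The canonical symplectic form in coordinates -/

section Symplectic

variable {E : Type*} [NormedAddCommGroup E] [NormedSpace ℝ E]
  {M : Type*} [TopologicalSpace M] [ChartedSpace E M] [IsManifold 𝓘(ℝ, E) ∞ M]

/-- The differential at `p` of the chart of `T*M` at `a`. -/
def cotChartDeriv (a p : CotangentBundle E M) : E × (E →L[ℝ] ℝ) →L[ℝ] E × (E →L[ℝ] ℝ) :=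
  mfderiv (cotModel E) 𝓘(ℝ, E × (E →L[ℝ] ℝ)) (extChartAt (cotModel E) a) p

/-- The differential at `z` of the inverse of the chart of `T*M` at `a`. -/
def cotChartSymmDeriv (a : CotangentBundle E M) (z : E × (E →L[ℝ] ℝ)) :
    E × (E →L[ℝ] ℝ) →L[ℝ] E × (E →L[ℝ] ℝ) :=
  mfderiv 𝓘(ℝ, E × (E →L[ℝ] ℝ)) (cotModel E) (extChartAt (cotModel E) a).symm z

theorem cotChartSymmDeriv_comp_cotChartDeriv {a p : CotangentBundle E M}
    (hp : p ∈ (extChartAt (cotModel E) a).source) :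
    (cotChartSymmDeriv a (extChartAt (cotModel E) a p)).comp (cotChartDeriv a p) =
      ContinuousLinearMap.id ℝ _ := by
  have := mfderivWithin_extChartAt_symm_comp_mfderiv_extChartAt' (I := cotModel E) hp
  simpa only [ModelWithCorners.range_eq_univ, mfderivWithin_univ] using! this

theorem cotChartDeriv_comp_cotChartSymmDeriv {a p : CotangentBundle E M}
    (hp : p ∈ (extChartAt (cotModel E) a).source) :
    (cotChartDeriv a p).comp (cotChartSymmDeriv a (extChartAt (cotModel E) a p)) =
      ContinuousLinearMap.id ℝ _ := by
  have := mfderiv_extChartAt_comp_mfderivWithin_extChartAt_symm' (I := cotModel E) hp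
  simpa only [ModelWithCorners.range_eq_univ, mfderivWithin_univ] using! this

theorem cotChartDeriv_self (p : CotangentBundle E M) :
    cotChartDeriv p p = ContinuousLinearMap.id ℝ _ :=
  mfderiv_extChartAt_self (I := cotModel E) (x := p)

theorem mdifferentiableAt_cotChart_symm {a : CotangentBundle E M} {z : E × (E →L[ℝ] ℝ)}
    (hz : z ∈ (extChartAt (cotModel E) a).target) :
    MDifferentiableAt 𝓘(ℝ, E × (E →L[ℝ] ℝ)) (cotModel E) (extChartAt (cotModel E) a).symm z := by
  have := mdifferentiableWithinAt_extChartAt_symm (I := cotModel E) hz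
  rwa [ModelWithCorners.range_eq_univ, mdifferentiableWithinAt_univ] at this

/-- This is `θ = ∑ pᵢ dqⁱ`. The bundle projection reads as `Prod.fst` in charts, so `w` is sent to
the base vector with coordinates `w.1`; the differential of the base chart inside the covector then
cancels that of its inverse. -/
theorem tautologicalFormInChart_apply {a : CotangentBundle E M} {z : E × (E →L[ℝ] ℝ)}
    (hz : z.1 ∈ (extChartAt 𝓘(ℝ, E) a.proj).target) (w : E × (E →L[ℝ] ℝ)) :
    tautologicalFormInChart a z w = z.2 w.1 := by
  have hz' : z ∈ (extChartAt (cotModel E) a).target := by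
    rw [extChartAt_cotangent_target]
    exact ⟨hz, mem_univ _⟩
  have h1 := mfderiv_comp z (g := (TotalSpace.proj : CotangentBundle E M → M))
    (I' := cotModel E) (I'' := 𝓘(ℝ, E))
    ((contMDiffAt_proj (n := 1) (IB := 𝓘(ℝ, E)) (fun x : M => TangentSpace 𝓘(ℝ, E) x →L[ℝ] Trivial M ℝ x)).mdifferentiableAt (by simp))
    (mdifferentiableAt_cotChart_symm hz')
  have h2 : (TotalSpace.proj : CotangentBundle E M → M) ∘ (extChartAt (cotModel E) a).symm =ᶠ[𝓝 z]
      (extChartAt 𝓘(ℝ, E) a.proj).symm ∘ Prod.fst := by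
    filter_upwards [(isOpen_extChartAt_target a).mem_nhds hz'] with y hy
    rw [extChartAt_cotangent_target] at hy
    rw [Function.comp_apply, extChartAt_cotangent_symm_apply a hy.1]
    rfl
  have h3 : MDifferentiableAt 𝓘(ℝ, E) 𝓘(ℝ, E) (extChartAt 𝓘(ℝ, E) a.proj).symm z.1 := by
    have := mdifferentiableWithinAt_extChartAt_symm (I := 𝓘(ℝ, E)) hz
    rwa [ModelWithCorners.range_eq_univ, mdifferentiableWithinAt_univ] at this
  have h4 := mfderiv_comp z (g := (extChartAt 𝓘(ℝ, E) a.proj).symm) (f := Prod.fst)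
    (I := 𝓘(ℝ, E × (E →L[ℝ] ℝ))) h3 (differentiableAt_fst.mdifferentiableAt)
  rw [← h2.mfderiv_eq, h1] at h4
  have h5 : mfderiv 𝓘(ℝ, E × (E →L[ℝ] ℝ)) 𝓘(ℝ, E) (Prod.fst : E × (E →L[ℝ] ℝ) → E) z w = w.1 := by
    rw [mfderiv_eq_fderiv, fderiv_fst]
    rfl
  have h6 := (DFunLike.congr_fun h4 w).trans
    (congrArg (mfderiv 𝓘(ℝ, E) 𝓘(ℝ, E) (extChartAt 𝓘(ℝ, E) a.proj).symm z.1) h5)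
  have h7 := congrArg (fun p : CotangentBundle E M => (show E →L[ℝ] ℝ from p.2)
    (chartSymmDeriv a.proj z.1 w.1)) (extChartAt_cotangent_symm_apply a hz)
  refine (congrArg (show E →L[ℝ] ℝ from ((extChartAt (cotModel E) a).symm z).2) h6).trans
    (h7.trans ?_)
  have h8 := DFunLike.congr_fun (chartDeriv_comp_chartSymmDeriv hz) w.1
  exact congrArg z.2 h8

theorem mem_target_of_fst_mem {a : CotangentBundle E M} {z : E × (E →L[ℝ] ℝ)}
    (hz : z.1 ∈ (extChartAt 𝓘(ℝ, E) a.proj).target) : z ∈ (extChartAt (cotModel E) a).target := by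
  rw [extChartAt_cotangent_target]
  exact ⟨hz, mem_univ _⟩

theorem fst_mem_of_mem_target {a : CotangentBundle E M} {z : E × (E →L[ℝ] ℝ)}
    (hz : z ∈ (extChartAt (cotModel E) a).target) : z.1 ∈ (extChartAt 𝓘(ℝ, E) a.proj).target := by
  rw [extChartAt_cotangent_target] at hz
  exact hz.1

set_option synthInstance.maxHeartbeats 400000 in
/-- The symplectic form in coordinates. -/
theorem canonicalSymplecticForm_eq (p : CotangentBundle E M) (u v : E × (E →L[ℝ] ℝ)) :
    canonicalSymplecticForm p u v = v.2 u.1 - u.2 v.1 := by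
  -- In coordinates `θ` depends linearly on the point, so it is its own derivative.
  let L : E × (E →L[ℝ] ℝ) →L[ℝ] E × (E →L[ℝ] ℝ) →L[ℝ] ℝ :=
    ((ContinuousLinearMap.compL ℝ (E × (E →L[ℝ] ℝ)) E ℝ).flip
      (ContinuousLinearMap.fst ℝ E (E →L[ℝ] ℝ))).comp (ContinuousLinearMap.snd ℝ E (E →L[ℝ] ℝ))
  have h1 : tautologicalFormInChart p =ᶠ[𝓝 (extChartAt (cotModel E) p p)] L := by
    filter_upwards [(isOpen_extChartAt_target p).mem_nhds (mem_extChartAt_target p)] with z hz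
    exact ContinuousLinearMap.ext fun w =>
      tautologicalFormInChart_apply (fst_mem_of_mem_target hz) w
  have h3 : fderiv ℝ (tautologicalFormInChart p) (extChartAt (cotModel E) p p) = L :=
    h1.fderiv_eq.trans (ContinuousLinearMap.fderiv (𝕜 := ℝ) (E := E × (E →L[ℝ] ℝ))
      (F := E × (E →L[ℝ] ℝ) →L[ℝ] ℝ) L)
  -- The tangent space at `p` is identified with the model through the preferred chart at `p`
  -- itself.
  have h4 : ∀ w : E × (E →L[ℝ] ℝ), cotChartDeriv p p w = w := fun w => by
    rw [cotChartDeriv_self]; rfl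
  change fderiv ℝ (tautologicalFormInChart p) (extChartAt (cotModel E) p p)
    (cotChartDeriv p p v) (cotChartDeriv p p u) - fderiv ℝ (tautologicalFormInChart p)
      (extChartAt (cotModel E) p p) (cotChartDeriv p p u) (cotChartDeriv p p v) = _
  rw [h4, h4, h3]
  rfl

/-- The charts of `T*M` are symplectic. -/
theorem cotChartDeriv_symplectic {a p : CotangentBundle E M}
    (hp : p ∈ (extChartAt (cotModel E) a).source) (u v : E × (E →L[ℝ] ℝ)) :
    (cotChartDeriv a p v).2 (cotChartDeriv a p u).1 -
      (cotChartDeriv a p u).2 (cotChartDeriv a p v).1 = v.2 u.1 - u.2 v.1 := by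
  set τ := (extChartAt (cotModel E) a) ∘ (extChartAt (cotModel E) p).symm with hτdef
  set z₀ := extChartAt (cotModel E) p p with hz₀
  have hz₀t : z₀ ∈ (extChartAt (cotModel E) p).target := mem_extChartAt_target p
  have hpz : (extChartAt (cotModel E) p).symm z₀ = p := extChartAt_to_inv p
  have hτ : ContDiffAt ℝ ∞ τ z₀ := by
    have := contDiffWithinAt_ext_coord_change (I := cotModel E) (n := ∞) a p (y := z₀) (by
      rw [PartialEquiv.trans_source, PartialEquiv.symm_source]
      exact ⟨hz₀t, by rw [mem_preimage, hpz]; exact hp⟩)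
    rwa [ModelWithCorners.range_eq_univ, contDiffWithinAt_univ] at this
  have hev : ∀ᶠ z in 𝓝 z₀, z ∈ (extChartAt (cotModel E) p).target ∧
      (extChartAt (cotModel E) p).symm z ∈ (extChartAt (cotModel E) a).source := by
    refine Filter.Eventually.and ((isOpen_extChartAt_target p).mem_nhds hz₀t) ?_
    have hc : ContinuousAt (extChartAt (cotModel E) p).symm z₀ := continuousAt_extChartAt_symm p
    refine hc.eventually ?_
    rw [hpz]
    exact (isOpen_extChartAt_source a).mem_nhds hp
  have hcomp : ∀ z ∈ (extChartAt (cotModel E) p).target,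
      (extChartAt (cotModel E) p).symm z ∈ (extChartAt (cotModel E) a).source →
      fderiv ℝ τ z = (cotChartDeriv a ((extChartAt (cotModel E) p).symm z)).comp
        (cotChartSymmDeriv p z) := by
    intro z hz hz'
    have h1 : MDifferentiableAt (cotModel E) 𝓘(ℝ, E × (E →L[ℝ] ℝ)) (extChartAt (cotModel E) a)
        ((extChartAt (cotModel E) p).symm z) :=
      mdifferentiableAt_extChartAt (by rwa [← extChartAt_source (cotModel E)])
    have h2 := mfderiv_comp z h1 (mdifferentiableAt_cotChart_symm hz)
    rw [mfderiv_eq_fderiv] at h2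
    exact h2
  -- Both coordinate expressions `z.2 w.1` come from the one global tautological form, so the change
  -- of charts `τ` preserves it, and hence its differential.
  have htaut : ∀ᶠ z in 𝓝 z₀, ∀ w, (τ z).2 ((fderiv ℝ τ z w).1) = z.2 w.1 := by
    filter_upwards [hev] with z hz w
    have hz1 : τ z ∈ (extChartAt (cotModel E) a).target :=
      (extChartAt (cotModel E) a).map_source hz.2
    have hz2 : (extChartAt (cotModel E) a).symm (τ z) = (extChartAt (cotModel E) p).symm z :=
      (extChartAt (cotModel E) a).left_inv hz.2
    rw [← tautologicalFormInChart_apply (fst_mem_of_mem_target hz1),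
      ← tautologicalFormInChart_apply (fst_mem_of_mem_target hz.1), hcomp z hz.1 hz.2]
    have h5 := DFunLike.congr_fun (cotChartSymmDeriv_comp_cotChartDeriv hz.2)
      (cotChartSymmDeriv p z w)
    have h6 := congrArg (fun q : CotangentBundle E M =>
      (show E × (E →L[ℝ] ℝ) →L[ℝ] ℝ from tautologicalForm q) (cotChartSymmDeriv p z w)) hz2
    exact (congrArg (show E × (E →L[ℝ] ℝ) →L[ℝ] ℝ from
      tautologicalForm ((extChartAt (cotModel E) a).symm (τ z))) h5).trans h6
  have hfin := symplectic_of_preserves_tautological (hτ.of_le (by norm_cast)) htaut u v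
  -- At its own centre the inverse chart has the identity as differential, so only the chart at `a`
  -- contributes.
  have hD : fderiv ℝ τ z₀ = cotChartDeriv a p := by
    rw [hcomp z₀ hz₀t (by rw [hpz]; exact hp), hpz]
    have := cotChartSymmDeriv_comp_cotChartDeriv (mem_extChartAt_source (I := cotModel E) p)
    rw [cotChartDeriv_self] at this
    rw [← hz₀, ContinuousLinearMap.comp_id] at this
    rw [this]
    rfl
  rwa [hD] at hfin

end Symplectic

/-! ### Integral curves of Hamiltonian vector fields -/

section HamiltonianFlow

variable {E : Type*} [NormedAddCommGroup E] [NormedSpace ℝ E]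
  {M : Type*} [TopologicalSpace M] [ChartedSpace E M] [IsManifold 𝓘(ℝ, E) ∞ M]

/-- Makes the set of times at which two integral curves differ open. Covectors over distinct points
are separated by the projection, covectors over the same point by a chart that contains both. -/
instance t2Space_cotangentBundle [T2Space M] : T2Space (CotangentBundle E M) := by
  rw [t2Space_iff_disjoint_nhds]
  intro x y hxy
  by_cases h : x.proj = y.proj
  · have hy : y ∈ (extChartAt (cotModel E) x).source := by
      rw [extChartAt_cotangent_source]
      exact h ▸ mem_extChartAt_source (I := 𝓘(ℝ, E)) x.proj
    have hx := mem_extChartAt_source (I := cotModel E) x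
    exact Filter.Tendsto.disjoint (continuousAt_extChartAt x)
      (disjoint_nhds_nhds.2 fun he => hxy ((extChartAt (cotModel E) x).injOn hx hy he))
      (continuousAt_extChartAt' hy)
  · have hc := FiberBundle.continuous_proj (E →L[ℝ] ℝ)
      (fun x : M => TangentSpace 𝓘(ℝ, E) x →L[ℝ] Trivial M ℝ x)
    exact Filter.Tendsto.disjoint hc.continuousAt (disjoint_nhds_nhds.2 h) hc.continuousAt

theorem hasDerivAt_extChartAt_comp {Γ : ℝ → CotangentBundle E M} {a : CotangentBundle E M} {t : ℝ}
    {X : E × (E →L[ℝ] ℝ)} (hΓ : Γ t ∈ (extChartAt (cotModel E) a).source)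
    (h : HasMFDerivAt 𝓘(ℝ, ℝ) (cotModel E) Γ t ((1 : ℝ →L[ℝ] ℝ).smulRight X)) :
    HasDerivAt (extChartAt (cotModel E) a ∘ Γ) (cotChartDeriv a (Γ t) X) t := by
  have h1 : HasMFDerivAt (cotModel E) 𝓘(ℝ, E × (E →L[ℝ] ℝ)) (extChartAt (cotModel E) a) (Γ t)
      (cotChartDeriv a (Γ t)) :=
    (mdifferentiableAt_extChartAt (by rwa [← extChartAt_source (cotModel E)])).hasMFDerivAt
  have h2 : HasFDerivAt (extChartAt (cotModel E) a ∘ Γ)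
      ((1 : ℝ →L[ℝ] ℝ).smulRight (cotChartDeriv a (Γ t) X)) t :=
    (h1.comp t h).hasFDerivAt.congr_fderiv
      (ContinuousLinearMap.ext fun s => (cotChartDeriv a (Γ t)).map_smul s X)
  exact h2.hasDerivAt.congr_deriv (one_smul ℝ _)

theorem hasMFDerivAt_extChartAt_symm_comp {z : ℝ → E × (E →L[ℝ] ℝ)} {a : CotangentBundle E M}
    {t : ℝ} {X : E × (E →L[ℝ] ℝ)} (hz : z t ∈ (extChartAt (cotModel E) a).target)
    (h : HasDerivAt z X t) :
    HasMFDerivAt 𝓘(ℝ, ℝ) (cotModel E) ((extChartAt (cotModel E) a).symm ∘ z) t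
      ((1 : ℝ →L[ℝ] ℝ).smulRight (cotChartSymmDeriv a (z t) X)) := by
  have h1 := (mdifferentiableAt_cotChart_symm hz).hasMFDerivAt
  have h2 := h1.comp t h.hasFDerivAt.hasMFDerivAt
  refine h2.congr_mfderiv ?_
  refine ContinuousLinearMap.ext fun s => ?_
  exact (cotChartSymmDeriv a (z t)).map_smul s X

variable {H : CotangentBundle E M → ℝ}

theorem contDiffAt_comp_extChartAt_symm (hH : ContMDiff (cotModel E) 𝓘(ℝ, ℝ) ∞ H)
    {a : CotangentBundle E M} {z : E × (E →L[ℝ] ℝ)} (hz : z ∈ (extChartAt (cotModel E) a).target) :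
    ContDiffAt ℝ 2 (H ∘ (extChartAt (cotModel E) a).symm) z := by
  have h1 := (contMDiffOn_extChartAt_symm (I := cotModel E) (n := ∞) a).contMDiffAt
    ((isOpen_extChartAt_target a).mem_nhds hz)
  have h2 := ContMDiffAt.comp z (hH _) h1
  exact h2.contDiffAt.of_le (by norm_cast)

variable [FiniteDimensional ℝ E]

/-- The field is defined by a choice, so its defining equation has to be shown solvable: in
coordinates this is the nondegeneracy of the canonical form in finite dimension. -/
theorem hamiltonianVectorField_spec (H : CotangentBundle E M → ℝ) (p : CotangentBundle E M)
    (w : TangentSpace (cotModel E) p) :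
    canonicalSymplecticForm p (hamiltonianVectorField H p) w =
      mfderiv (cotModel E) 𝓘(ℝ, ℝ) H p w := by
  refine Classical.epsilon_spec (p := fun X : TangentSpace (cotModel E) p =>
    ∀ w : TangentSpace (cotModel E) p,
      canonicalSymplecticForm p X w = mfderiv (cotModel E) 𝓘(ℝ, ℝ) H p w) ?_ w
  let l : E × (E →L[ℝ] ℝ) →L[ℝ] ℝ := mfderiv (cotModel E) 𝓘(ℝ, ℝ) H p
  refine ⟨(canonicalEquiv E).symm l, fun w => ?_⟩
  refine (canonicalSymplecticForm_eq p _ w).trans ?_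
  refine (canonicalEquiv_apply ((canonicalEquiv E).symm l) w).symm.trans ?_
  rw [ContinuousLinearEquiv.apply_symm_apply]
  rfl

/-- The Hamiltonian vector field in the charts of `T*M` is the symplectic gradient. -/
theorem cotChartDeriv_hamiltonianVectorField {H : CotangentBundle E M → ℝ}
    {a p : CotangentBundle E M} (hp : p ∈ (extChartAt (cotModel E) a).source)
    (hH : MDifferentiableAt (cotModel E) 𝓘(ℝ, ℝ) H p) :
    cotChartDeriv a p (hamiltonianVectorField H p) =
      symplecticGradient (H ∘ (extChartAt (cotModel E) a).symm) (extChartAt (cotModel E) a p) := by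
  have hpt := (extChartAt (cotModel E) a).map_source hp
  have hinv := (extChartAt (cotModel E) a).left_inv hp
  refine eq_symplecticGradient fun w => ?_
  have hw := DFunLike.congr_fun (cotChartDeriv_comp_cotChartSymmDeriv hp) w
  have hw' : cotChartDeriv a p (cotChartSymmDeriv a (extChartAt (cotModel E) a p) w) = w := hw
  -- A test vector `w` of the model is the image of `w'` under the chart. As the chart is
  -- symplectic, the defining equation of the field at `w'` becomes that of the symplectic gradient
  -- at `w`.
  set w' := cotChartSymmDeriv a (extChartAt (cotModel E) a p) w with hw'def
  have h1 := cotChartDeriv_symplectic hp (hamiltonianVectorField H p) w'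
  have h2 := (canonicalSymplecticForm_eq p (hamiltonianVectorField H p) w').symm
  rw [hw'] at h1
  refine h1.trans (h2.trans ((hamiltonianVectorField_spec H p w').trans ?_))
  have hH' : MDifferentiableAt (cotModel E) 𝓘(ℝ, ℝ) H
    ((extChartAt (cotModel E) a).symm (extChartAt (cotModel E) a p)) := by rwa [hinv]
  have h3 := mfderiv_comp (extChartAt (cotModel E) a p) hH' (mdifferentiableAt_cotChart_symm hpt)
  rw [mfderiv_eq_fderiv] at h3
  have h4 := DFunLike.congr_fun h3 w
  refine Eq.trans ?_ h4.symm
  exact congrArg (fun q : CotangentBundle E M =>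
    (show E × (E →L[ℝ] ℝ) →L[ℝ] ℝ from mfderiv (cotModel E) 𝓘(ℝ, ℝ) H q) w') hinv.symm

/-- Integral curves of the Hamiltonian vector field satisfy Hamilton's equations. -/
theorem hamilton_of_isMIntegralCurveAt (hH : ContMDiff (cotModel E) 𝓘(ℝ, ℝ) ∞ H)
    {Γ : ℝ → CotangentBundle E M} {a : CotangentBundle E M} {t₀ : ℝ}
    (hΓ : IsMIntegralCurveAt (I := cotModel E) Γ (hamiltonianVectorField H) t₀)
    (h0 : Γ t₀ ∈ (extChartAt (cotModel E) a).source) :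
    ∀ᶠ t in 𝓝 t₀, HasDerivAt (extChartAt (cotModel E) a ∘ Γ)
      (symplecticGradient (H ∘ (extChartAt (cotModel E) a).symm)
        ((extChartAt (cotModel E) a ∘ Γ) t)) t := by
  have h1 := hΓ.continuousAt.eventually ((isOpen_extChartAt_source a).mem_nhds h0)
  have hΓ' : ∀ᶠ t in 𝓝 t₀, HasMFDerivAt 𝓘(ℝ, ℝ) (cotModel E) Γ t
    ((1 : ℝ →L[ℝ] ℝ).smulRight (hamiltonianVectorField H (Γ t))) := hΓ
  filter_upwards [h1, hΓ'] with t ht ht'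
  have h2 := hasDerivAt_extChartAt_comp ht ht'
  rw [cotChartDeriv_hamiltonianVectorField ht ((hH _).mdifferentiableAt (by simp))] at h2
  exact h2

/-- Solutions of Hamilton's equations are integral curves of the Hamiltonian vector field. -/
theorem isMIntegralCurveAt_of_hamilton (hH : ContMDiff (cotModel E) 𝓘(ℝ, ℝ) ∞ H)
    {z : ℝ → E × (E →L[ℝ] ℝ)} {a : CotangentBundle E M} {t₀ : ℝ}
    (h0 : z t₀ ∈ (extChartAt (cotModel E) a).target)
    (hz : ∀ᶠ t in 𝓝 t₀,
      HasDerivAt z (symplecticGradient (H ∘ (extChartAt (cotModel E) a).symm) (z t)) t) :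
    IsMIntegralCurveAt (I := cotModel E) ((extChartAt (cotModel E) a).symm ∘ z)
      (hamiltonianVectorField H) t₀ := by
  have h1 := hz.self_of_nhds.continuousAt.eventually ((isOpen_extChartAt_target a).mem_nhds h0)
  refine Filter.Eventually.mono (h1.and hz) fun t ht => ?_
  have h2 := hasMFDerivAt_extChartAt_symm_comp ht.1 ht.2
  have h3 := (extChartAt (cotModel E) a).map_target ht.1
  have h4 := cotChartDeriv_hamiltonianVectorField (H := H) h3 ((hH _).mdifferentiableAt (by simp))
  have h5 := DFunLike.congr_fun (cotChartSymmDeriv_comp_cotChartDeriv h3)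
    (hamiltonianVectorField H ((extChartAt (cotModel E) a).symm (z t)))
  have h6 := congrArg (cotChartSymmDeriv a
    (extChartAt (cotModel E) a ((extChartAt (cotModel E) a).symm (z t)))) h4
  have h7 := h6.symm.trans h5
  rw [(extChartAt (cotModel E) a).right_inv ht.1] at h7
  exact h2.congr_mfderiv (congrArg (fun X : E × (E →L[ℝ] ℝ) => (1 : ℝ →L[ℝ] ℝ).smulRight X) h7)

theorem isMIntegralCurveAt_hamiltonian_unique (hH : ContMDiff (cotModel E) 𝓘(ℝ, ℝ) ∞ H)
    {Γ Γ' : ℝ → CotangentBundle E M} {t₀ : ℝ}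
    (hΓ : IsMIntegralCurveAt (I := cotModel E) Γ (hamiltonianVectorField H) t₀)
    (hΓ' : IsMIntegralCurveAt (I := cotModel E) Γ' (hamiltonianVectorField H) t₀)
    (h0 : Γ t₀ = Γ' t₀) : Γ =ᶠ[𝓝 t₀] Γ' := by
  have hs : Γ t₀ ∈ (extChartAt (cotModel E) (Γ t₀)).source := mem_extChartAt_source _
  have hs' : Γ' t₀ ∈ (extChartAt (cotModel E) (Γ t₀)).source := h0 ▸ hs
  have h1 := hamilton_unique
    (z := extChartAt (cotModel E) (Γ t₀) ∘ Γ) (z' := extChartAt (cotModel E) (Γ t₀) ∘ Γ')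
    (contDiffAt_comp_extChartAt_symm hH ((extChartAt (cotModel E) (Γ t₀)).map_source hs))
    (congrArg _ h0) (hamilton_of_isMIntegralCurveAt hH hΓ hs)
    (hamilton_of_isMIntegralCurveAt hH hΓ' hs')
  filter_upwards [h1, hΓ.continuousAt.eventually ((isOpen_extChartAt_source _).mem_nhds hs),
    hΓ'.continuousAt.eventually ((isOpen_extChartAt_source _).mem_nhds hs')] with t ht h2 h3
  exact (extChartAt (cotModel E) (Γ t₀)).injOn h2 h3 ht

/-- The times of agreement form an open set by local uniqueness, and so do the times of
disagreement, because `T*M` is Hausdorff. A preconnected `J` cannot meet both. -/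
theorem isMIntegralCurveOn_hamiltonian_unique [T2Space M]
    (hH : ContMDiff (cotModel E) 𝓘(ℝ, ℝ) ∞ H) {Γ Γ' : ℝ → CotangentBundle E M} {J : Set ℝ}
    (hJ : IsOpen J) (hJ' : IsPreconnected J)
    (hΓ : IsMIntegralCurveOn (I := cotModel E) Γ (hamiltonianVectorField H) J)
    (hΓ' : IsMIntegralCurveOn (I := cotModel E) Γ' (hamiltonianVectorField H) J)
    {t₀ : ℝ} (ht₀ : t₀ ∈ J) (h0 : Γ t₀ = Γ' t₀) : EqOn Γ Γ' J := by
  rw [isMIntegralCurveOn_iff_isMIntegralCurveAt hJ] at hΓ hΓ'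
  by_contra hne
  simp only [EqOn, not_forall] at hne
  obtain ⟨t₁, ht₁, hne⟩ := hne
  have hu : IsOpen {t | t ∈ J ∧ Γ t = Γ' t} := by
    rw [isOpen_iff_mem_nhds]
    rintro t ⟨ht, he⟩
    exact Filter.Eventually.and (hJ.mem_nhds ht)
      (isMIntegralCurveAt_hamiltonian_unique hH (hΓ t ht) (hΓ' t ht) he)
  have hv : IsOpen {t | t ∈ J ∧ Γ t ≠ Γ' t} := by
    rw [isOpen_iff_mem_nhds]
    rintro t ⟨ht, he⟩
    exact Filter.Eventually.and (hJ.mem_nhds ht)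
      (((hΓ t ht).continuousAt.prodMk (hΓ' t ht).continuousAt).eventually
        (isClosed_diagonal.isOpen_compl.mem_nhds he))
  obtain ⟨t, -, h1, h2⟩ := hJ' _ _ hu hv
    (fun t ht => (em (Γ t = Γ' t)).imp (fun h => ⟨ht, h⟩) fun h => ⟨ht, h⟩)
    ⟨t₀, ht₀, ht₀, h0⟩ ⟨t₁, ht₁, ht₁, hne⟩
  exact h2.2 h1.2

end HamiltonianFlow

/-! ### Pulled back covectors in coordinates -/

section Lift

variable {E : Type*} [NormedAddCommGroup E] [NormedSpace ℝ E]
  {M : Type*} [TopologicalSpace M] [ChartedSpace E M] [IsManifold 𝓘(ℝ, E) ∞ M]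
  {F : Type*} [NormedAddCommGroup F] [NormedSpace ℝ F]
  {N : Type*} [TopologicalSpace N] [ChartedSpace F N] [IsManifold 𝓘(ℝ, F) ∞ N]
  {pr : M → N}

/-- `p = pr^* q` for some base point. -/
def IsPulledBack (pr : M → N) (p : CotangentBundle E M) (q : CotangentBundle F N) : Prop :=
  ∃ (m : M) (μ : TangentSpace 𝓘(ℝ, F) (pr m) →L[ℝ] ℝ), p = cotangentPullback pr m μ ∧ q = ⟨pr m, μ⟩

/-- The map `pr` read in the preferred charts at `m` and `pr m`. -/
def inCharts (E F : Type*) [NormedAddCommGroup E] [NormedSpace ℝ E] [NormedAddCommGroup F]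
    [NormedSpace ℝ F] [ChartedSpace E M] [ChartedSpace F N] (pr : M → N) (m : M) : E → F :=
  extChartAt 𝓘(ℝ, F) (pr m) ∘ pr ∘ (extChartAt 𝓘(ℝ, E) m).symm

/-- The covector at `n` with components `ν` in the preferred chart at `c`. -/
def chartCovector (c : N) (ν : F →L[ℝ] ℝ) (n : N) : TangentSpace 𝓘(ℝ, F) n →L[ℝ] ℝ :=
  show F →L[ℝ] ℝ from ν.comp (chartDeriv F c n)

theorem chartCovector_self (c : N) (ν : TangentSpace 𝓘(ℝ, F) c →L[ℝ] ℝ) :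
    chartCovector c (show F →L[ℝ] ℝ from ν) c = ν := by
  have h : chartDeriv F c c = ContinuousLinearMap.id ℝ F :=
    mfderiv_extChartAt_self (I := 𝓘(ℝ, F)) (x := c)
  change (show F →L[ℝ] ℝ from ν).comp (chartDeriv F c c) = _
  rw [h]
  rfl

theorem fderiv_inCharts (hpr : ContMDiff 𝓘(ℝ, E) 𝓘(ℝ, F) ∞ pr) {m : M} {x : E}
    (hx : x ∈ (extChartAt 𝓘(ℝ, E) m).target)
    (hx' : pr ((extChartAt 𝓘(ℝ, E) m).symm x) ∈ (extChartAt 𝓘(ℝ, F) (pr m)).source) :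
    fderiv ℝ (inCharts E F pr m) x =
      (chartDeriv F (pr m) (pr ((extChartAt 𝓘(ℝ, E) m).symm x))).comp
        ((show E →L[ℝ] F from mfderiv 𝓘(ℝ, E) 𝓘(ℝ, F) pr ((extChartAt 𝓘(ℝ, E) m).symm x)).comp
          (chartSymmDeriv m x)) := by
  have h1 : MDifferentiableAt 𝓘(ℝ, F) 𝓘(ℝ, F) (extChartAt 𝓘(ℝ, F) (pr m))
      (pr ((extChartAt 𝓘(ℝ, E) m).symm x)) :=
    mdifferentiableAt_extChartAt (by rwa [← extChartAt_source 𝓘(ℝ, F)])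
  have h2 : MDifferentiableAt 𝓘(ℝ, E) 𝓘(ℝ, F) pr ((extChartAt 𝓘(ℝ, E) m).symm x) :=
    (hpr _).mdifferentiableAt (by simp)
  have h3 : MDifferentiableAt 𝓘(ℝ, E) 𝓘(ℝ, E) (extChartAt 𝓘(ℝ, E) m).symm x := by
    have := mdifferentiableWithinAt_extChartAt_symm (I := 𝓘(ℝ, E)) hx
    rwa [ModelWithCorners.range_eq_univ, mdifferentiableWithinAt_univ] at this
  have h4 : HasFDerivAt (inCharts E F pr m)
      ((chartDeriv F (pr m) (pr ((extChartAt 𝓘(ℝ, E) m).symm x))).comp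
        ((show E →L[ℝ] F from mfderiv 𝓘(ℝ, E) 𝓘(ℝ, F) pr ((extChartAt 𝓘(ℝ, E) m).symm x)).comp
          (chartSymmDeriv m x))) x :=
    (h1.hasMFDerivAt.comp x (h2.hasMFDerivAt.comp x h3.hasMFDerivAt)).hasFDerivAt
  exact h4.fderiv

theorem chartSymmDeriv_bijective {c : M} {y : E} (hy : y ∈ (extChartAt 𝓘(ℝ, E) c).target) :
    Function.Bijective (chartSymmDeriv c y) :=
  Function.bijective_iff_has_inverse.2 ⟨chartDeriv E c ((extChartAt 𝓘(ℝ, E) c).symm y),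
    fun v => DFunLike.congr_fun (chartDeriv_comp_chartSymmDeriv hy) v,
    fun v => DFunLike.congr_fun (chartSymmDeriv_comp_chartDeriv hy) v⟩

theorem chartDeriv_bijective {c x : M} (hx : x ∈ (extChartAt 𝓘(ℝ, E) c).source) :
    Function.Bijective (chartDeriv E c x) := by
  have hy := (extChartAt 𝓘(ℝ, E) c).map_source hx
  rw [← (extChartAt 𝓘(ℝ, E) c).left_inv hx]
  exact Function.bijective_iff_has_inverse.2 ⟨chartSymmDeriv c _,
    fun v => DFunLike.congr_fun (chartSymmDeriv_comp_chartDeriv hy) v,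
    fun v => DFunLike.congr_fun (chartDeriv_comp_chartSymmDeriv hy) v⟩

theorem fderiv_inCharts_surjective (hpr : ContMDiff 𝓘(ℝ, E) 𝓘(ℝ, F) ∞ pr) {m : M} {x : E}
    (hsurj : ∀ m, Function.Surjective (mfderiv 𝓘(ℝ, E) 𝓘(ℝ, F) pr m))
    (hx : x ∈ (extChartAt 𝓘(ℝ, E) m).target)
    (hx' : pr ((extChartAt 𝓘(ℝ, E) m).symm x) ∈ (extChartAt 𝓘(ℝ, F) (pr m)).source) :
    Function.Surjective (fderiv ℝ (inCharts E F pr m) x) := by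
  rw [fderiv_inCharts hpr hx hx']
  exact (chartDeriv_bijective hx').surjective.comp
    ((hsurj _).comp (chartSymmDeriv_bijective hx).surjective)

theorem contDiffAt_inCharts (hpr : ContMDiff 𝓘(ℝ, E) 𝓘(ℝ, F) ∞ pr) {m : M} {x : E}
    (hx : x ∈ (extChartAt 𝓘(ℝ, E) m).target)
    (hx' : pr ((extChartAt 𝓘(ℝ, E) m).symm x) ∈ (extChartAt 𝓘(ℝ, F) (pr m)).source) :
    ContDiffAt ℝ ∞ (inCharts E F pr m) x := by
  have h1 := (contMDiffOn_extChartAt_symm (I := 𝓘(ℝ, E)) (n := ∞) m).contMDiffAt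
    ((isOpen_extChartAt_target m).mem_nhds hx)
  have h2 := (contMDiffOn_extChartAt (I := 𝓘(ℝ, F)) (n := ∞) (x := pr m)).contMDiffAt
    ((chartAt F (pr m)).open_source.mem_nhds (by rwa [← extChartAt_source 𝓘(ℝ, F)]))
  exact (h2.comp x ((hpr _).comp x h1)).contDiffAt

/-- The points where `inCharts` represents `pr` form a neighbourhood. -/
theorem eventually_mem_charts (hpr : Continuous pr) (m : M) :
    ∀ᶠ x in 𝓝 (extChartAt 𝓘(ℝ, E) m m), x ∈ (extChartAt 𝓘(ℝ, E) m).target ∧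
      pr ((extChartAt 𝓘(ℝ, E) m).symm x) ∈ (extChartAt 𝓘(ℝ, F) (pr m)).source := by
  refine Filter.Eventually.and ((isOpen_extChartAt_target m).mem_nhds (mem_extChartAt_target m)) ?_
  have hc : ContinuousAt (pr ∘ (extChartAt 𝓘(ℝ, E) m).symm) (extChartAt 𝓘(ℝ, E) m m) :=
    hpr.continuousAt.comp (continuousAt_extChartAt_symm m)
  refine hc.eventually ((isOpen_extChartAt_source (pr m)).mem_nhds ?_)
  rw [Function.comp_apply, extChartAt_to_inv]
  exact mem_extChartAt_source _

theorem extChartAt_symm_inCharts {b : CotangentBundle F N} {m : M} (hb : b.proj = pr m) {x : E}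
    (hx' : pr ((extChartAt 𝓘(ℝ, E) m).symm x) ∈ (extChartAt 𝓘(ℝ, F) (pr m)).source)
    (ν : F →L[ℝ] ℝ) :
    (extChartAt (cotModel F) b).symm (inCharts E F pr m x, ν) =
      ⟨pr ((extChartAt 𝓘(ℝ, E) m).symm x),
        chartCovector (pr m) ν (pr ((extChartAt 𝓘(ℝ, E) m).symm x))⟩ := by
  have h1 : (inCharts E F pr m x) ∈ (extChartAt 𝓘(ℝ, F) b.proj).target := by
    rw [hb]
    exact (extChartAt 𝓘(ℝ, F) (pr m)).map_source hx'
  rw [extChartAt_cotangent_symm_apply b h1, hb]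
  exact congrArg (fun n : N => (⟨n, chartCovector (pr m) ν n⟩ : CotangentBundle F N))
    ((extChartAt 𝓘(ℝ, F) (pr m)).left_inv hx')

/-- The pull-back of covectors in coordinates is `(x, ν) ↦ (x, ν ∘ Df(x))`, the form used in
`exists_hamilton_lift`: the chart at `a.proj` enters once through its differential and once through
the inverse, which cancel. -/
theorem extChartAt_symm_pullback (hpr : ContMDiff 𝓘(ℝ, E) 𝓘(ℝ, F) ∞ pr) {a : CotangentBundle E M}
    {x : E} (hx : x ∈ (extChartAt 𝓘(ℝ, E) a.proj).target)
    (hx' : pr ((extChartAt 𝓘(ℝ, E) a.proj).symm x) ∈ (extChartAt 𝓘(ℝ, F) (pr a.proj)).source)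
    (ν : F →L[ℝ] ℝ) :
    (extChartAt (cotModel E) a).symm (x, ν.comp (fderiv ℝ (inCharts E F pr a.proj) x)) =
      cotangentPullback pr ((extChartAt 𝓘(ℝ, E) a.proj).symm x)
        (chartCovector (pr a.proj) ν (pr ((extChartAt 𝓘(ℝ, E) a.proj).symm x))) := by
  rw [extChartAt_cotangent_symm_apply a hx, fderiv_inCharts hpr hx hx']
  refine congrArg (fun l : E →L[ℝ] ℝ => (⟨(extChartAt 𝓘(ℝ, E) a.proj).symm x, l⟩ :
    CotangentBundle E M)) ?_
  have h := chartSymmDeriv_comp_chartDeriv hx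
  refine ContinuousLinearMap.ext fun v => ?_
  have h' : chartSymmDeriv a.proj x (chartDeriv E a.proj
    ((extChartAt 𝓘(ℝ, E) a.proj).symm x) v) = v := DFunLike.congr_fun h v
  exact congrArg (fun u : E => ν (chartDeriv F (pr a.proj) (pr ((extChartAt 𝓘(ℝ, E) a.proj).symm x))
    ((show E →L[ℝ] F from mfderiv 𝓘(ℝ, E) 𝓘(ℝ, F) pr ((extChartAt 𝓘(ℝ, E) a.proj).symm x)) u))) h'

/-- Pulled back covectors in coordinates. -/
theorem isPulledBack_iff_coord (hpr : ContMDiff 𝓘(ℝ, E) 𝓘(ℝ, F) ∞ pr) {a p : CotangentBundle E M}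
    (hp : p ∈ (extChartAt (cotModel E) a).source)
    (hp' : pr p.proj ∈ (extChartAt 𝓘(ℝ, F) (pr a.proj)).source) :
    (∃ q : CotangentBundle F N, IsPulledBack pr p q) ↔ ∃ ν : F →L[ℝ] ℝ, (extChartAt (cotModel E) a p).2 =
      ν.comp (fderiv ℝ (inCharts E F pr a.proj) (extChartAt (cotModel E) a p).1) := by
  have hps : p.proj ∈ (extChartAt 𝓘(ℝ, E) a.proj).source := by
    rwa [extChartAt_cotangent_source] at hp
  have hc1 : (extChartAt (cotModel E) a p).1 = extChartAt 𝓘(ℝ, E) a.proj p.proj :=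
    congrArg Prod.fst (extChartAt_cotangent_apply a hps)
  have hx := (extChartAt 𝓘(ℝ, E) a.proj).map_source hps
  have hl := (extChartAt 𝓘(ℝ, E) a.proj).left_inv hps
  have key := extChartAt_symm_pullback hpr hx (by rwa [hl])
  rw [hc1]
  constructor
  · rintro ⟨q, m, μ, rfl, -⟩
    have hm : m ∈ (extChartAt 𝓘(ℝ, E) a.proj).source := hps
    have hm' : pr m ∈ (extChartAt 𝓘(ℝ, F) (pr a.proj)).source := hp'
    have hl' : (extChartAt 𝓘(ℝ, E) a.proj).symm (extChartAt 𝓘(ℝ, E) a.proj m) = m := hl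
    -- The components of `μ` in the chart at `pr a.proj`.
    refine ⟨(show F →L[ℝ] ℝ from μ).comp
      (chartSymmDeriv (pr a.proj) (extChartAt 𝓘(ℝ, F) (pr a.proj) (pr m))), ?_⟩
    have key' := key ((show F →L[ℝ] ℝ from μ).comp
      (chartSymmDeriv (pr a.proj) (extChartAt 𝓘(ℝ, F) (pr a.proj) (pr m))))
    have h1 : chartCovector (pr a.proj) ((show F →L[ℝ] ℝ from μ).comp
        (chartSymmDeriv (pr a.proj) (extChartAt 𝓘(ℝ, F) (pr a.proj) (pr m)))) (pr m) = μ := by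
      have h2 := chartSymmDeriv_comp_chartDeriv ((extChartAt 𝓘(ℝ, F) (pr a.proj)).map_source hm')
      rw [(extChartAt 𝓘(ℝ, F) (pr a.proj)).left_inv hm'] at h2
      exact congrArg (fun A : F →L[ℝ] F => (show F →L[ℝ] ℝ from μ).comp A) h2
    have h3 : (fun m' : M => cotangentPullback (E := E) pr m' (chartCovector (pr a.proj)
        ((show F →L[ℝ] ℝ from μ).comp
        (chartSymmDeriv (pr a.proj) (extChartAt 𝓘(ℝ, F) (pr a.proj) (pr m)))) (pr m'))) m =
        cotangentPullback pr m μ := congrArg (cotangentPullback pr m) h1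
    have h4 := congrArg (extChartAt (cotModel E) a) (key'.trans
      ((congrArg (fun m' : M => cotangentPullback (E := E) pr m' (chartCovector (pr a.proj)
        ((show F →L[ℝ] ℝ from μ).comp
        (chartSymmDeriv (pr a.proj) (extChartAt 𝓘(ℝ, F) (pr a.proj) (pr m)))) (pr m'))) hl').trans h3))
    rw [(extChartAt (cotModel E) a).right_inv (mem_target_of_fst_mem hx)] at h4
    exact (congrArg Prod.snd h4).symm
  · rintro ⟨ν, hν⟩
    refine ⟨_, (extChartAt 𝓘(ℝ, E) a.proj).symm (extChartAt 𝓘(ℝ, E) a.proj p.proj),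
      chartCovector (pr a.proj) ν _, ?_, rfl⟩
    rw [← key ν, ← hν, ← hc1]
    exact ((extChartAt (cotModel E) a).left_inv hp).symm

/-- The covectors that annihilate the kernel of a submersion form a closed set. -/
theorem isClosed_pulledBack [FiniteDimensional ℝ E] [FiniteDimensional ℝ F]
    (hpr : ContMDiff 𝓘(ℝ, E) 𝓘(ℝ, F) ∞ pr)
    (hsurj : ∀ m, Function.Surjective (mfderiv 𝓘(ℝ, E) 𝓘(ℝ, F) pr m)) :
    IsClosed {p : CotangentBundle E M | ∃ q : CotangentBundle F N, IsPulledBack pr p q} := by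
  rw [← isOpen_compl_iff, isOpen_iff_mem_nhds]
  intro a ha
  have has : a ∈ (extChartAt (cotModel E) a).source := mem_extChartAt_source a
  set x₀ := extChartAt 𝓘(ℝ, E) a.proj a.proj with hx₀
  set f := inCharts E F pr a.proj with hf
  have hx₀t : x₀ ∈ (extChartAt 𝓘(ℝ, E) a.proj).target := mem_extChartAt_target a.proj
  have hx₀i : (extChartAt 𝓘(ℝ, E) a.proj).symm x₀ = a.proj := extChartAt_to_inv a.proj
  have hx₀s : pr ((extChartAt 𝓘(ℝ, E) a.proj).symm x₀) ∈
      (extChartAt 𝓘(ℝ, F) (pr a.proj)).source := by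
    rw [hx₀i]
    exact mem_extChartAt_source _
  have hc1 : (extChartAt (cotModel E) a a).1 = x₀ :=
    congrArg Prod.fst (extChartAt_cotangent_apply a (mem_extChartAt_source (I := 𝓘(ℝ, E)) a.proj))
  have hfs : Function.Surjective (fderiv ℝ f x₀) :=
    fderiv_inCharts_surjective hpr hsurj hx₀t hx₀s
  obtain ⟨R, hR⟩ := (fderiv ℝ f x₀ : E →ₗ[ℝ] F).exists_rightInverse_of_surjective
    (LinearMap.range_eq_top.2 hfs)
  have hcf : ContinuousAt (fderiv ℝ f) x₀ :=
    ((contDiffAt_inCharts hpr hx₀t hx₀s).fderiv_right (m := 1) (by norm_cast)).continuousAt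
  -- `R` is a right inverse of `Df(x₀)`, so `B x₀` is the identity and `B x` stays invertible
  -- nearby. Thus `R ∘ (B x)⁻¹` is a right inverse of `Df(x)` that is continuous at `x₀`.
  let B : E → F →L[ℝ] F := fun x => (fderiv ℝ f x).comp (LinearMap.toContinuousLinearMap R)
  have hB0 : B x₀ = (ContinuousLinearEquiv.refl ℝ F : F →L[ℝ] F) := by
    ext v
    exact DFunLike.congr_fun hR v
  have hBc : ContinuousAt B x₀ := hcf.clm_comp continuousAt_const
  have hBinv : ContinuousAt (fun x => (B x).inverse) x₀ := by
    have h1 : ContinuousAt ContinuousLinearMap.inverse (B x₀) := by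
      rw [hB0]
      exact (contDiffAt_map_inverse (n := 1) (ContinuousLinearEquiv.refl ℝ F)).continuousAt
    exact ContinuousAt.comp (g := ContinuousLinearMap.inverse) h1 hBc
  have hBunit : ∀ᶠ x in 𝓝 x₀, (B x).IsInvertible := by
    have := (ContinuousLinearEquiv.nhds (ContinuousLinearEquiv.refl ℝ F))
    rw [← hB0] at this
    exact hBc.eventually this
  -- With `S` that right inverse of `Df(x)`, a covector `λ` factors through `Df(x)` if and only if
  -- `λ = λ ∘ S ∘ Df(x)`. So `G` vanishes exactly on pulled back covectors near `a`, and `G ≠ 0` is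
  -- an open condition at `a`.
  let G : E × (E →L[ℝ] ℝ) → E →L[ℝ] ℝ := fun z =>
    z.2 - (z.2.comp ((LinearMap.toContinuousLinearMap R).comp (B z.1).inverse)).comp (fderiv ℝ f z.1)
  have hG : ContinuousAt (G ∘ extChartAt (cotModel E) a) a := by
    have h1 : ContinuousAt (fun z : E × (E →L[ℝ] ℝ) => (B z.1).inverse)
        (extChartAt (cotModel E) a a) :=
      ContinuousAt.comp (g := fun x => (B x).inverse) (by rwa [hc1]) continuousAt_fst
    have h2 : ContinuousAt (fun z : E × (E →L[ℝ] ℝ) => fderiv ℝ f z.1)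
        (extChartAt (cotModel E) a a) :=
      ContinuousAt.comp (g := fderiv ℝ f) (by rwa [hc1]) continuousAt_fst
    have h3 : ContinuousAt G (extChartAt (cotModel E) a a) :=
      continuousAt_snd.sub ((continuousAt_snd.clm_comp (continuousAt_const.clm_comp h1)).clm_comp h2)
    exact h3.comp (continuousAt_extChartAt a)
  have hG0 : (G ∘ extChartAt (cotModel E) a) a ≠ 0 := by
    intro h0
    refine ha ((isPulledBack_iff_coord hpr has (mem_extChartAt_source _)).2 ⟨_, sub_eq_zero.1 h0⟩)
  have e1 : ∀ᶠ p in 𝓝 a, p ∈ (extChartAt (cotModel E) a).source :=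
    (isOpen_extChartAt_source a).mem_nhds has
  have hproj := FiberBundle.continuous_proj (E →L[ℝ] ℝ)
    (fun x : M => TangentSpace 𝓘(ℝ, E) x →L[ℝ] Trivial M ℝ x)
  have e2 : ∀ᶠ p : CotangentBundle E M in 𝓝 a,
      pr p.proj ∈ (extChartAt 𝓘(ℝ, F) (pr a.proj)).source :=
    (hpr.continuous.comp hproj).continuousAt.eventually
      ((isOpen_extChartAt_source (pr a.proj)).mem_nhds (mem_extChartAt_source (pr a.proj)))
  have e3 : ∀ᶠ p in 𝓝 a, (B (extChartAt (cotModel E) a p).1).IsInvertible := by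
    have hc : ContinuousAt (fun p => (extChartAt (cotModel E) a p).1) a :=
      continuousAt_fst.comp (continuousAt_extChartAt a)
    have hb : ∀ᶠ x in 𝓝 (extChartAt (cotModel E) a a).1, (B x).IsInvertible := by rwa [hc1]
    exact hc.eventually hb
  filter_upwards [e1, e2, e3, hG.eventually_ne hG0] with p h1 h2 h3 h4 h5
  obtain ⟨ν, hν⟩ := (isPulledBack_iff_coord hpr h1 h2).1 h5
  refine h4 (sub_eq_zero.2 ?_)
  rw [hν]
  have h6 := h3.self_comp_inverse
  ext v
  exact (congrArg ν (DFunLike.congr_fun h6 (fderiv ℝ f (extChartAt (cotModel E) a p).1 v))).symm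

end Lift

/-! ### Projection of Hamiltonian flows -/

section Reduction

variable {E : Type*} [NormedAddCommGroup E] [NormedSpace ℝ E] [FiniteDimensional ℝ E]
  {M : Type*} [TopologicalSpace M] [ChartedSpace E M] [IsManifold 𝓘(ℝ, E) ∞ M]
  {F : Type*} [NormedAddCommGroup F] [NormedSpace ℝ F] [FiniteDimensional ℝ F]
  {N : Type*} [TopologicalSpace N] [ChartedSpace F N] [IsManifold 𝓘(ℝ, F) ∞ N]
  {pr : M → N} {H : CotangentBundle E M → ℝ} {k : CotangentBundle F N → ℝ}

/-- The base point `m` is read off from `p`, and the transpose of a surjective differential is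
injective. -/
theorem IsPulledBack.unique (hsurj : ∀ m, Function.Surjective (mfderiv 𝓘(ℝ, E) 𝓘(ℝ, F) pr m))
    {p : CotangentBundle E M} {q q' : CotangentBundle F N} (h : IsPulledBack pr p q)
    (h' : IsPulledBack pr p q') : q = q' := by
  obtain ⟨m, μ, rfl, rfl⟩ := h
  obtain ⟨m', μ', h1, rfl⟩ := h'
  obtain rfl : m = m' := congrArg TotalSpace.proj h1
  have h2 : (show E →L[ℝ] ℝ from μ.comp (mfderiv 𝓘(ℝ, E) 𝓘(ℝ, F) pr m)) =
      (show E →L[ℝ] ℝ from μ'.comp (mfderiv 𝓘(ℝ, E) 𝓘(ℝ, F) pr m)) := by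
    simpa only [cotangentPullback, TotalSpace.mk.injEq, heq_eq_eq, true_and] using! h1
  have h3 : μ = μ' := by
    refine ContinuousLinearMap.ext fun v => ?_
    obtain ⟨w, rfl⟩ := hsurj m v
    exact DFunLike.congr_fun h2 w
  rw [h3]

/-- If two Hamiltonians correspond to each other under the pull-back of covectors, then an integral
curve of the second one lifts locally to an integral curve of the first one. -/
theorem exists_isMIntegralCurveAt_lift (hpr : ContMDiff 𝓘(ℝ, E) 𝓘(ℝ, F) ∞ pr)
    (hH : ContMDiff (cotModel E) 𝓘(ℝ, ℝ) ∞ H) (hk : ContMDiff (cotModel F) 𝓘(ℝ, ℝ) ∞ k)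
    (hrel : ∀ (m : M) (μ : TangentSpace 𝓘(ℝ, F) (pr m) →L[ℝ] ℝ),
      H (cotangentPullback pr m μ) = k ⟨pr m, μ⟩) (t₀ : ℝ) {p : CotangentBundle E M}
    {q : CotangentBundle F N} (hpq : IsPulledBack pr p q) :
    ∃ (Γ : ℝ → CotangentBundle E M) (Δ : ℝ → CotangentBundle F N), Γ t₀ = p ∧ Δ t₀ = q ∧
      IsMIntegralCurveAt (I := cotModel E) Γ (hamiltonianVectorField H) t₀ ∧
      IsMIntegralCurveAt (I := cotModel F) Δ (hamiltonianVectorField k) t₀ ∧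
      ∀ᶠ t in 𝓝 t₀, IsPulledBack pr (Γ t) (Δ t) := by
  obtain ⟨m, μ, rfl, rfl⟩ := hpq
  set a : CotangentBundle E M := cotangentPullback pr m μ with ha
  set b : CotangentBundle F N := ⟨pr m, μ⟩ with hb
  set x₀ := extChartAt 𝓘(ℝ, E) m m with hx₀
  set f := inCharts E F pr m with hf
  let ν₀ : F →L[ℝ] ℝ := μ
  have hev := eventually_mem_charts (E := E) (F := F) hpr.continuous m
  obtain ⟨hx₀t, hx₀s⟩ := hev.self_of_nhds
  have hx₀i : (extChartAt 𝓘(ℝ, E) m).symm x₀ = m := extChartAt_to_inv m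
  have hfx : f x₀ ∈ (extChartAt 𝓘(ℝ, F) (pr m)).target :=
    (extChartAt 𝓘(ℝ, F) (pr m)).map_source hx₀s
  -- Each parameter `(x, ν)` gives a pulled back covector and the covector it comes from. This both
  -- transfers `hrel` to the charts and shows that the two curves stay related.
  have hrel' : ∀ x ∈ (extChartAt 𝓘(ℝ, E) m).target,
      pr ((extChartAt 𝓘(ℝ, E) m).symm x) ∈ (extChartAt 𝓘(ℝ, F) (pr m)).source → ∀ ν : F →L[ℝ] ℝ,
      IsPulledBack pr ((extChartAt (cotModel E) a).symm (x, ν.comp (fderiv ℝ f x)))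
        ((extChartAt (cotModel F) b).symm (f x, ν)) := fun x hx hx' ν =>
    ⟨_, _, extChartAt_symm_pullback (a := a) hpr hx hx' ν,
      extChartAt_symm_inCharts (b := b) (m := m) rfl hx' ν⟩
  obtain ⟨x, ν, hxt, hνt, hode⟩ := exists_hamilton_lift (f := f)
    (h := H ∘ (extChartAt (cotModel E) a).symm) (k := k ∘ (extChartAt (cotModel F) b).symm)
    (x₀ := x₀) (ν₀ := ν₀) t₀ ((contDiffAt_inCharts hpr hx₀t hx₀s).of_le (by norm_cast))
    (contDiffAt_comp_extChartAt_symm hH (mem_target_of_fst_mem hx₀t))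
    (contDiffAt_comp_extChartAt_symm hk (mem_target_of_fst_mem hfx)) (by
      have h1 : ∀ᶠ z : E × (F →L[ℝ] ℝ) in 𝓝 (x₀, ν₀), z.1 ∈ (extChartAt 𝓘(ℝ, E) m).target ∧
          pr ((extChartAt 𝓘(ℝ, E) m).symm z.1) ∈ (extChartAt 𝓘(ℝ, F) (pr m)).source :=
        (continuousAt_fst (p := (x₀, ν₀))).eventually hev
      filter_upwards [h1] with z hz
      obtain ⟨m', μ', h2, h3⟩ := hrel' z.1 hz.1 hz.2 z.2
      rw [Function.comp_apply, Function.comp_apply, h2, h3, hrel])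
  refine ⟨(extChartAt (cotModel E) a).symm ∘ fun t => (x t, (ν t).comp (fderiv ℝ f (x t))),
    (extChartAt (cotModel F) b).symm ∘ fun t => (f (x t), ν t), ?_, ?_,
    isMIntegralCurveAt_of_hamilton hH ?_ (hode.mono fun t ht => ht.1),
    isMIntegralCurveAt_of_hamilton hk ?_ (hode.mono fun t ht => ht.2), ?_⟩
  · simp only [Function.comp_apply, hxt, hνt]
    refine (extChartAt_symm_pullback (a := a) hpr hx₀t hx₀s ν₀).trans ?_
    refine (congrArg (fun m' : M => cotangentPullback (E := E) pr m'
      (chartCovector (pr m) ν₀ (pr m'))) hx₀i).trans ?_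
    exact congrArg (cotangentPullback pr m) (chartCovector_self (pr m) μ)
  · simp only [Function.comp_apply, hxt, hνt]
    refine (extChartAt_symm_inCharts (b := b) (m := m) rfl hx₀s ν₀).trans ?_
    refine (congrArg (fun m' : M => (⟨pr m', chartCovector (pr m) ν₀ (pr m')⟩ :
      CotangentBundle F N)) hx₀i).trans ?_
    exact congrArg (fun l => (⟨pr m, l⟩ : CotangentBundle F N)) (chartCovector_self (pr m) μ)
  · exact mem_target_of_fst_mem (by rw [hxt]; exact hx₀t)
  · exact mem_target_of_fst_mem (by rw [hxt]; exact hfx)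
  · have hc : ContinuousAt x t₀ := continuousAt_fst.comp hode.self_of_nhds.1.continuousAt
    have h1 := hc.eventually (by rwa [hxt] : ∀ᶠ y in 𝓝 (x t₀), _)
    filter_upwards [h1] with t ht using hrel' (x t) ht.1 ht.2 (ν t)

/-- An integral curve of the first of two corresponding Hamiltonians that starts at a pulled back
covector stays pulled back, and projects to an integral curve of the second one. -/
theorem exists_isMIntegralCurveOn_proj (hpr : ContMDiff 𝓘(ℝ, E) 𝓘(ℝ, F) ∞ pr)
    (hsurj : ∀ m, Function.Surjective (mfderiv 𝓘(ℝ, E) 𝓘(ℝ, F) pr m))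
    (hH : ContMDiff (cotModel E) 𝓘(ℝ, ℝ) ∞ H) (hk : ContMDiff (cotModel F) 𝓘(ℝ, ℝ) ∞ k)
    (hrel : ∀ (m : M) (μ : TangentSpace 𝓘(ℝ, F) (pr m) →L[ℝ] ℝ),
      H (cotangentPullback pr m μ) = k ⟨pr m, μ⟩) {J : Set ℝ} (hJ : IsOpen J)
    (hJ' : IsPreconnected J) {t₀ : ℝ} (ht₀ : t₀ ∈ J) {Γ : ℝ → CotangentBundle E M}
    (hΓ : IsMIntegralCurveOn (I := cotModel E) Γ (hamiltonianVectorField H) J)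
    {q : CotangentBundle F N} (hq : IsPulledBack pr (Γ t₀) q) :
    ∃ Δ : ℝ → CotangentBundle F N, Δ t₀ = q ∧
      IsMIntegralCurveOn (I := cotModel F) Δ (hamiltonianVectorField k) J ∧
      ∀ t ∈ J, IsPulledBack pr (Γ t) (Δ t) := by
  rw [isMIntegralCurveOn_iff_isMIntegralCurveAt hJ] at hΓ
  -- By uniqueness `Γ` agrees near `t₁` with the lifted curve through `Γ t₁`.
  have hloc : ∀ t₁ ∈ J, ∀ q₁ : CotangentBundle F N, IsPulledBack pr (Γ t₁) q₁ →
      ∃ Δ : ℝ → CotangentBundle F N,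
        IsMIntegralCurveAt (I := cotModel F) Δ (hamiltonianVectorField k) t₁ ∧
        ∀ᶠ t in 𝓝 t₁, IsPulledBack pr (Γ t) (Δ t) := by
    intro t₁ ht₁ q₁ hq₁
    obtain ⟨Γ', Δ, h1, h2, h3, h4, h5⟩ := exists_isMIntegralCurveAt_lift hpr hH hk hrel t₁ hq₁
    refine ⟨Δ, h4, ?_⟩
    filter_upwards [h5, isMIntegralCurveAt_hamiltonian_unique hH (hΓ t₁ ht₁) h3 h1.symm] with t h6 h7
    rwa [h7]
  -- The times at which `Γ` is pulled back form an open set by `hloc`, and a relatively closed one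
  -- by `isClosed_pulledBack`; `J` is preconnected.
  have hall : ∀ t ∈ J, ∃ q : CotangentBundle F N, IsPulledBack pr (Γ t) q := by
    by_contra hne
    push Not at hne
    obtain ⟨t₁, ht₁, hne⟩ := hne
    have hu : IsOpen {t | t ∈ J ∧ ∃ q : CotangentBundle F N, IsPulledBack pr (Γ t) q} := by
      rw [isOpen_iff_mem_nhds]
      rintro t ⟨ht, q₁, hq₁⟩
      obtain ⟨Δ, -, h⟩ := hloc t ht q₁ hq₁
      exact Filter.Eventually.and (hJ.mem_nhds ht) (h.mono fun t ht => ⟨_, ht⟩)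
    have hv : IsOpen {t | t ∈ J ∧ ¬ ∃ q : CotangentBundle F N, IsPulledBack pr (Γ t) q} := by
      rw [isOpen_iff_mem_nhds]
      rintro t ⟨ht, he⟩
      exact Filter.Eventually.and (hJ.mem_nhds ht) ((hΓ t ht).continuousAt.eventually
        ((isClosed_pulledBack hpr hsurj).isOpen_compl.mem_nhds he))
    obtain ⟨t, -, h1, h2⟩ := hJ' _ _ hu hv
      (fun t ht => (em (∃ q : CotangentBundle F N, IsPulledBack pr (Γ t) q)).imp
        (fun h => ⟨ht, h⟩) fun h => ⟨ht, h⟩)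
      ⟨t₀, ht₀, ht₀, q, hq⟩ ⟨t₁, ht₁, ht₁, fun ⟨q, hq⟩ => hne q hq⟩
    exact h2.2 h1.2
  have : Nonempty (CotangentBundle F N) := ⟨q⟩
  -- The choice is made separately at each time, without continuity. Injectivity of the pull-back
  -- then forces `Δ` to agree near each time with the local integral curve from `hloc`.
  choose! Δ hΔ using hall
  refine ⟨Δ, (hΔ t₀ ht₀).unique hsurj hq, ?_, hΔ⟩
  rw [isMIntegralCurveOn_iff_isMIntegralCurveAt hJ]
  intro t₁ ht₁
  obtain ⟨Δ', h1, h2⟩ := hloc t₁ ht₁ _ (hΔ t₁ ht₁)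
  have h3 : Δ' =ᶠ[𝓝 t₁] Δ := by
    filter_upwards [h2, hJ.mem_nhds ht₁] with t h4 h5 using h4.unique hsurj (hΔ t h5)
  have h1' : ∀ᶠ t in 𝓝 t₁, HasMFDerivAt 𝓘(ℝ, ℝ) (cotModel F) Δ' t
    ((1 : ℝ →L[ℝ] ℝ).smulRight (hamiltonianVectorField k (Δ' t))) := h1
  refine Filter.Eventually.mono (h1'.and h3.eventuallyEq_nhds) fun t ht => ?_
  rw [← ht.2.eq_of_nhds]
  exact ht.1.congr_of_eventuallyEq ht.2.symm

/-- The geodesics of corresponding sub-Riemannian Hamiltonians. -/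
theorem isSRGeodesicOn_proj [T2Space N] (hpr : ContMDiff 𝓘(ℝ, E) 𝓘(ℝ, F) ∞ pr)
    (hsurj : ∀ m, Function.Surjective (mfderiv 𝓘(ℝ, E) 𝓘(ℝ, F) pr m))
    {D : Set (TangentBundle 𝓘(ℝ, E) M)}
    {gD : ∀ x : M, TangentSpace 𝓘(ℝ, E) x → TangentSpace 𝓘(ℝ, E) x → ℝ}
    {D' : Set (TangentBundle 𝓘(ℝ, F) N)}
    {gD' : ∀ x : N, TangentSpace 𝓘(ℝ, F) x → TangentSpace 𝓘(ℝ, F) x → ℝ}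
    (hH : ContMDiff (cotModel E) 𝓘(ℝ, ℝ) ∞ (hamiltonian D gD))
    (hk : ContMDiff (cotModel F) 𝓘(ℝ, ℝ) ∞ (hamiltonian D' gD'))
    (hrel : ∀ (m : M) (μ : TangentSpace 𝓘(ℝ, F) (pr m) →L[ℝ] ℝ),
      hamiltonian D gD (cotangentPullback pr m μ) = hamiltonian D' gD' ⟨pr m, μ⟩)
    (m : M) (μ : TangentSpace 𝓘(ℝ, F) (pr m) →L[ℝ] ℝ) :
    (∃ ε > 0, ∃ γ : ℝ → M, IsSRGeodesicOn D gD (cotangentPullback pr m μ) γ (Ioo (-ε) ε)) ∧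
    ∀ J : Set ℝ, IsOpen J → J.OrdConnected → (0 : ℝ) ∈ J →
      ∀ γ : ℝ → M, IsSRGeodesicOn D gD (cotangentPullback pr m μ) γ J →
        IsSRGeodesicOn D' gD' ⟨pr m, μ⟩ (fun t => pr (γ t)) J ∧
        ∀ γ' : ℝ → N, IsSRGeodesicOn D' gD' ⟨pr m, μ⟩ γ' J → ∀ t ∈ J, pr (γ t) = γ' t := by
  have hpq : IsPulledBack pr (cotangentPullback pr m μ : CotangentBundle E M)
    (⟨pr m, μ⟩ : CotangentBundle F N) := ⟨m, μ, rfl, rfl⟩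
  constructor
  · obtain ⟨Γ, -, h1, -, h2, -⟩ := exists_isMIntegralCurveAt_lift hpr hH hk hrel 0 hpq
    obtain ⟨ε, hε, h3⟩ := isMIntegralCurveAt_iff'.1 h2
    rw [Real.ball_eq_Ioo, zero_sub, zero_add] at h3
    exact ⟨ε, hε, fun t => (Γ t).proj, Γ, h1, h3, fun _ _ => rfl⟩
  · rintro J hJ hJc h0 γ ⟨Γ, h1, h2, h3⟩
    have hJ' : IsPreconnected J := isPreconnected_iff_ordConnected.2 hJc
    obtain ⟨Δ, h4, h5, h6⟩ := exists_isMIntegralCurveOn_proj hpr hsurj hH hk hrel hJ hJ' h0 h2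
      (q := ⟨pr m, μ⟩) (by rw [h1]; exact hpq)
    have h7 : ∀ t ∈ J, pr (γ t) = (Δ t).proj := by
      intro t ht
      obtain ⟨m', μ', e1, e2⟩ := h6 t ht
      rw [h3 t ht, e1, e2]
      rfl
    refine ⟨⟨Δ, h4, h5, h7⟩, ?_⟩
    rintro γ' ⟨Δ', g1, g2, g3⟩ t ht
    rw [h7 t ht, g3 t ht, isMIntegralCurveOn_hamiltonian_unique hk hJ hJ' h5 g2 h0
      (h4.trans g1.symm) ht]

end Reduction

/-! ### A smooth formula for the sharp map on `(ker A)^⊥` -/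

section LinearAlgebra

variable {E F : Type*} [NormedAddCommGroup E] [NormedSpace ℝ E] [FiniteDimensional ℝ E]
  [NormedAddCommGroup F] [NormedSpace ℝ F] [FiniteDimensional ℝ F]

theorem isInvertible_of_injective {V W : Type*} [NormedAddCommGroup V] [NormedSpace ℝ V]
    [FiniteDimensional ℝ V] [NormedAddCommGroup W] [NormedSpace ℝ W] [FiniteDimensional ℝ W]
    (A : V →L[ℝ] W) (hA : Function.Injective A)
    (h : Module.finrank ℝ V = Module.finrank ℝ W) : A.IsInvertible :=
  ⟨(LinearEquiv.ofInjectiveOfFinrankEq (A : V →ₗ[ℝ] W) hA h).toContinuousLinearEquiv, by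
    ext v
    rfl⟩

theorem contDiffAt_inverse {V W : Type*} [NormedAddCommGroup V] [NormedSpace ℝ V]
    [FiniteDimensional ℝ V] [NormedAddCommGroup W] [NormedSpace ℝ W] {A : V →L[ℝ] W}
    (hA : A.IsInvertible) {n : WithTop ℕ∞} : ContDiffAt ℝ n ContinuousLinearMap.inverse A := by
  have := FiniteDimensional.complete ℝ V
  obtain ⟨e, rfl⟩ := hA
  exact contDiffAt_map_inverse e

/-- The map `F* → F` that is the restriction of the cometric of `G` to the range of the transpose of
`A`. -/
def cometricOn (G : E →L[ℝ] E →L[ℝ] ℝ) (A : E →L[ℝ] F) : (F →L[ℝ] ℝ) →L[ℝ] F :=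
  A.comp (G.inverse.comp ((ContinuousLinearMap.compL ℝ E F ℝ).flip A))

/-- The sharp of the covector `p` for the restriction of the inner product `G` to the orthogonal
complement of the kernel of `A`. -/
def orthogonalSharp (G : E →L[ℝ] E →L[ℝ] ℝ) (A : E →L[ℝ] F) (p : E →L[ℝ] ℝ) : E :=
  G.inverse (((cometricOn G A).inverse (A (G.inverse p))).comp A)

variable {G : E →L[ℝ] E →L[ℝ] ℝ} {A : E →L[ℝ] F}

theorem isInvertible_of_posDef (hpos : ∀ v, v ≠ 0 → 0 < G v v) : G.IsInvertible := by
  refine isInvertible_of_injective G ?_ (finrank_continuousDual E)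
  rw [injective_iff_map_eq_zero]
  intro v hv
  by_contra hne
  have := hpos v hne
  rw [hv] at this
  simp at this

/-- If `ν` is in the kernel, then `v = G⁻¹(ν ∘ A)` satisfies `G(v, v) = ν(A v) = 0`, so `v = 0`, `ν
∘ A = 0`, and `ν = 0` since `A` is onto. -/
theorem isInvertible_cometricOn (hpos : ∀ v, v ≠ 0 → 0 < G v v)
    (hA : Function.Surjective A) : (cometricOn G A).IsInvertible := by
  refine isInvertible_of_injective _ ?_ (finrank_continuousDual F).symm
  rw [injective_iff_map_eq_zero]
  intro ν hν
  have hν' : A (G.inverse (ν.comp A)) = 0 := hν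
  have h1 : G (G.inverse (ν.comp A)) = ν.comp A := (isInvertible_of_posDef hpos).self_apply_inverse _
  have h2 : G.inverse (ν.comp A) = 0 := by
    by_contra hne
    have h3 := hpos _ hne
    rw [h1, ContinuousLinearMap.comp_apply, hν', map_zero] at h3
    exact lt_irrefl _ h3
  rw [h2, map_zero] at h1
  ext y
  obtain ⟨x, rfl⟩ := hA y
  exact (DFunLike.congr_fun h1 x).symm

theorem orthogonalSharp_orthogonal (hpos : ∀ v, v ≠ 0 → 0 < G v v) (p : E →L[ℝ] ℝ) {w : E}
    (hw : A w = 0) : G (orthogonalSharp G A p) w = 0 := by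
  rw [orthogonalSharp, (isInvertible_of_posDef hpos).self_apply_inverse,
    ContinuousLinearMap.comp_apply, hw, map_zero]

/-- `orthogonalSharp G A p` and the full sharp `G⁻¹ p` have the same image under `A`. Their
difference lies in `ker A`, to which `w` is orthogonal. -/
theorem orthogonalSharp_spec (hpos : ∀ v, v ≠ 0 → 0 < G v v) (hsymm : ∀ v w, G v w = G w v)
    (hA : Function.Surjective A) (p : E →L[ℝ] ℝ) {w : E} (hw : ∀ v, A v = 0 → G w v = 0) :
    p w = G (orthogonalSharp G A p) w := by
  have h1 : A (orthogonalSharp G A p) = A (G.inverse p) :=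
    (isInvertible_cometricOn hpos hA).self_apply_inverse (A (G.inverse p))
  have h2 := hw (orthogonalSharp G A p - G.inverse p) (by rw [map_sub, h1, sub_self])
  rw [map_sub, sub_eq_zero, hsymm, hsymm w, (isInvertible_of_posDef hpos).self_apply_inverse] at h2
  exact h2.symm

-- The closed formula involves only compositions and inverses of invertible maps, so smoothness in
-- the data needs no local frame of the distribution.
set_option synthInstance.maxHeartbeats 400000 in
theorem contDiffAt_orthogonalSharp {V : Type*} [NormedAddCommGroup V] [NormedSpace ℝ V]
    {n : WithTop ℕ∞} {G : V → E →L[ℝ] E →L[ℝ] ℝ} {A : V → E →L[ℝ] F} {p : V → E →L[ℝ] ℝ} {x : V}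
    (hG : ContDiffAt ℝ n G x) (hA : ContDiffAt ℝ n A x) (hp : ContDiffAt ℝ n p x)
    (hpos : ∀ v, v ≠ 0 → 0 < G x v v) (hsurj : Function.Surjective (A x)) :
    ContDiffAt ℝ n (fun y => orthogonalSharp (G y) (A y) (p y)) x := by
  have h1 : ContDiffAt ℝ n (fun y => (G y).inverse) x :=
    ContDiffAt.comp x (g := ContinuousLinearMap.inverse)
      (contDiffAt_inverse (isInvertible_of_posDef hpos)) hG
  have h2 : ContDiff ℝ n (fun B : E →L[ℝ] F => (ContinuousLinearMap.compL ℝ E F ℝ).flip B) :=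
    contDiff_clm_apply_iff.2 fun ν => (contDiff_const (c := ν)).clm_comp contDiff_id
  have h3 : ContDiffAt ℝ n (fun y => cometricOn (G y) (A y)) x :=
    hA.clm_comp (h1.clm_comp (ContDiffAt.comp x h2.contDiffAt hA))
  have h4 : ContDiffAt ℝ n (fun y => (cometricOn (G y) (A y)).inverse) x :=
    ContDiffAt.comp x (g := ContinuousLinearMap.inverse)
      (contDiffAt_inverse (isInvertible_cometricOn hpos hsurj)) h3
  exact h1.clm_apply ((h4.clm_apply (hA.clm_apply (h1.clm_apply hp))).clm_comp hA)

end LinearAlgebra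

/-! ### Local sections of submersions -/

section Sections

variable {E : Type*} [NormedAddCommGroup E] [NormedSpace ℝ E]
  {M : Type*} [TopologicalSpace M] [ChartedSpace E M] [IsManifold 𝓘(ℝ, E) ∞ M]
  {F : Type*} [NormedAddCommGroup F] [NormedSpace ℝ F]
  {N : Type*} [TopologicalSpace N] [ChartedSpace F N] [IsManifold 𝓘(ℝ, F) ∞ N]
  {pr : M → N}

/-- A submersion has a smooth local section through every point. -/
theorem exists_localSection (hpr : Manifold.IsSubmersion 𝓘(ℝ, E) 𝓘(ℝ, F) ∞ pr) (m : M) :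
    ∃ s : N → M, ContMDiffAt 𝓘(ℝ, F) 𝓘(ℝ, E) ∞ s (pr m) ∧ s (pr m) = m ∧
      ∀ᶠ n in 𝓝 (pr m), pr (s n) = n := by
  have h := hpr.isSubmersionAt m
  let φ := h.domChart
  let ψ := h.codChart
  let e := h.equiv
  have hm : m ∈ φ.source := h.mem_domChart_source
  have hm' : pr m ∈ ψ.source := h.mem_codChart_source
  have hw : ∀ x ∈ φ.target, ψ (pr (φ.symm x)) = (e x).1 := by
    intro x hx
    exact h.writtenInCharts (by simpa using hx)
  have hsrc : ∀ x ∈ φ.target, pr (φ.symm x) ∈ ψ.source := fun x hx =>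
    h.source_subset_preimage_source (φ.map_target hx)
  -- In adapted charts `pr` is the first projection; the section freezes the second coordinate at
  -- its value at `m`.
  let ι : F → E := fun y => e.symm (y, (e (φ m)).2)
  have hι : ContDiff ℝ ∞ ι := e.symm.contDiff.comp (contDiff_id.prodMk contDiff_const)
  have hιm : ι (ψ (pr m)) = φ m := by
    have h1 := hw (φ m) (φ.map_source hm)
    rw [φ.left_inv hm] at h1
    change e.symm (ψ (pr m), (e (φ m)).2) = φ m
    rw [h1, Prod.mk.eta, e.symm_apply_apply]
  have hψ : ContMDiffAt 𝓘(ℝ, F) 𝓘(ℝ, F) ∞ ψ (pr m) :=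
    contMDiffAt_of_mem_maximalAtlas h.codChart_mem_maximalAtlas hm'
  have hιψ : ContMDiffAt 𝓘(ℝ, F) 𝓘(ℝ, E) ∞ (ι ∘ ψ) (pr m) :=
    hι.contMDiff.contMDiffAt.comp (pr m) hψ
  have hφ : ContMDiffAt 𝓘(ℝ, E) 𝓘(ℝ, E) ∞ φ.symm ((ι ∘ ψ) (pr m)) :=
    contMDiffAt_symm_of_mem_maximalAtlas h.domChart_mem_maximalAtlas (by
      rw [Function.comp_apply, hιm]
      exact φ.map_source hm)
  refine ⟨φ.symm ∘ ι ∘ ψ, hφ.comp (pr m) hιψ, ?_, ?_⟩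
  · rw [Function.comp_apply, Function.comp_apply, hιm, φ.left_inv hm]
  · have h1 : ∀ᶠ n in 𝓝 (pr m), (ι ∘ ψ) n ∈ φ.target :=
      hιψ.continuousAt.eventually (φ.open_target.mem_nhds (by
        rw [Function.comp_apply, hιm]
        exact φ.map_source hm))
    filter_upwards [h1, ψ.open_source.mem_nhds hm'] with n hn hn'
    refine ψ.injOn (hsrc _ hn) hn' ?_
    refine (hw _ hn).trans ?_
    change (e (e.symm (ψ n, (e (φ m)).2))).1 = ψ n
    rw [e.apply_symm_apply]

/-- Differentiate `pr ∘ s = id` for a local section `s` through `m`. -/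
theorem mfderiv_surjective_of_isSubmersion (hpr : Manifold.IsSubmersion 𝓘(ℝ, E) 𝓘(ℝ, F) ∞ pr)
    (m : M) : Function.Surjective (mfderiv 𝓘(ℝ, E) 𝓘(ℝ, F) pr m) := by
  obtain ⟨s, hs, hsm, hps⟩ := exists_localSection hpr m
  have h1 : MDifferentiableAt 𝓘(ℝ, E) 𝓘(ℝ, F) pr (s (pr m)) :=
    (hpr.contMDiff _).mdifferentiableAt (by simp)
  have h2 := mfderiv_comp (pr m) h1 (hs.mdifferentiableAt (by simp))
  have h3 : pr ∘ s =ᶠ[𝓝 (pr m)] id := hps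
  rw [h3.mfderiv_eq, mfderiv_id] at h2
  intro v
  have h4 := DFunLike.congr_fun h2 v
  have h5 : (show E →L[ℝ] F from mfderiv 𝓘(ℝ, E) 𝓘(ℝ, F) pr (s (pr m))) =
    (show E →L[ℝ] F from mfderiv 𝓘(ℝ, E) 𝓘(ℝ, F) pr m) :=
    congrArg (fun x => (show E →L[ℝ] F from mfderiv 𝓘(ℝ, E) 𝓘(ℝ, F) pr x)) hsm
  exact ⟨mfderiv 𝓘(ℝ, F) 𝓘(ℝ, E) s (pr m) v, (DFunLike.congr_fun h5 _).symm.trans h4.symm⟩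

/-- If a map is constant on the fibres of a submersion, then its differential vanishes on the
vertical vectors. -/
theorem mfderiv_eq_zero_of_fibre {F' : Type*} [NormedAddCommGroup F'] [NormedSpace ℝ F']
    {N' : Type*} [TopologicalSpace N'] [ChartedSpace F' N'] {pr' : M → N'}
    (hpr : Manifold.IsSubmersion 𝓘(ℝ, E) 𝓘(ℝ, F) ∞ pr) (hpr' : ContMDiff 𝓘(ℝ, E) 𝓘(ℝ, F') ∞ pr')
    (h : ∀ m m', pr m = pr m' → pr' m = pr' m') {m : M} {v : TangentSpace 𝓘(ℝ, E) m}
    (hv : mfderiv 𝓘(ℝ, E) 𝓘(ℝ, F) pr m v = 0) : mfderiv 𝓘(ℝ, E) 𝓘(ℝ, F') pr' m v = 0 := by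
  obtain ⟨s, hs, hsm, hps⟩ := exists_localSection hpr m
  -- Since `m'` and `s (pr m')` lie in the same fibre of `pr`, the map `pr'` factors smoothly
  -- through `pr` near `m`.
  have h1 : pr' =ᶠ[𝓝 m] (pr' ∘ s) ∘ pr := by
    filter_upwards [(hpr.contMDiff.continuous.continuousAt).eventually hps] with m' hm'
    exact h _ _ hm'.symm
  have h2 : MDifferentiableAt 𝓘(ℝ, F) 𝓘(ℝ, F') (pr' ∘ s) (pr m) :=
    ((hpr' _).comp (pr m) hs).mdifferentiableAt (by simp)
  have h3 := mfderiv_comp m h2 ((hpr.contMDiff m).mdifferentiableAt (by simp))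
  rw [← h1.mfderiv_eq] at h3
  refine (DFunLike.congr_fun h3 v).trans ?_
  refine (congrArg (mfderiv 𝓘(ℝ, F) 𝓘(ℝ, F') (pr' ∘ s) (pr m)) hv).trans ?_
  exact map_zero _

end Sections

/-! ### Smoothness of the horizontal Hamiltonian -/

section HorizontalHamiltonian

variable {E : Type*} [NormedAddCommGroup E] [NormedSpace ℝ E] [FiniteDimensional ℝ E]
  {M : Type*} [TopologicalSpace M] [ChartedSpace E M] [IsManifold 𝓘(ℝ, E) ∞ M]
  {F : Type*} [NormedAddCommGroup F] [NormedSpace ℝ F] [FiniteDimensional ℝ F]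
  {N : Type*} [TopologicalSpace N] [ChartedSpace F N] [IsManifold 𝓘(ℝ, F) ∞ N]
  {pr : M → N}

/-- `X` is the sharp of `lam`. -/
theorem sharp_eq {D : Set (TangentBundle 𝓘(ℝ, E) M)}
    {gD : ∀ x : M, TangentSpace 𝓘(ℝ, E) x → TangentSpace 𝓘(ℝ, E) x → ℝ} {x : M}
    {lam : TangentSpace 𝓘(ℝ, E) x →L[ℝ] ℝ} {X : TangentSpace 𝓘(ℝ, E) x}
    (hX : (⟨x, X⟩ : TangentBundle 𝓘(ℝ, E) M) ∈ D)
    (hX' : ∀ w : TangentSpace 𝓘(ℝ, E) x, (⟨x, w⟩ : TangentBundle 𝓘(ℝ, E) M) ∈ D → lam w = gD x X w)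
    (huniq : ∀ Y : TangentSpace 𝓘(ℝ, E) x, (⟨x, Y⟩ : TangentBundle 𝓘(ℝ, E) M) ∈ D →
      (∀ w : TangentSpace 𝓘(ℝ, E) x, (⟨x, w⟩ : TangentBundle 𝓘(ℝ, E) M) ∈ D →
        gD x Y w = gD x X w) → Y = X) : sharp D gD x lam = X := by
  have h := Classical.epsilon_spec (p := fun X : TangentSpace 𝓘(ℝ, E) x =>
    (⟨x, X⟩ : TangentBundle 𝓘(ℝ, E) M) ∈ D ∧
      ∀ w : TangentSpace 𝓘(ℝ, E) x, (⟨x, w⟩ : TangentBundle 𝓘(ℝ, E) M) ∈ D → lam w = gD x X w)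
    ⟨X, hX, hX'⟩
  exact huniq _ h.1 fun w hw => (h.2 w hw).symm.trans (hX' w hw)

theorem mem_horizontal_iff (g : Metric E M) {x : M} {v : TangentSpace 𝓘(ℝ, E) x} :
    (⟨x, v⟩ : TangentBundle 𝓘(ℝ, E) M) ∈ horizontal (F := F) g pr ↔
      ∀ w : TangentSpace 𝓘(ℝ, E) x, mfderiv 𝓘(ℝ, E) 𝓘(ℝ, F) pr x w = 0 → g.inner x v w = 0 :=
  Iff.rfl

theorem horizontal_sub (g : Metric E M) {x : M} {v w : TangentSpace 𝓘(ℝ, E) x}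
    (hv : (⟨x, v⟩ : TangentBundle 𝓘(ℝ, E) M) ∈ horizontal (F := F) g pr)
    (hw : (⟨x, w⟩ : TangentBundle 𝓘(ℝ, E) M) ∈ horizontal (F := F) g pr) :
    (⟨x, v - w⟩ : TangentBundle 𝓘(ℝ, E) M) ∈ horizontal (F := F) g pr := by
  rw [mem_horizontal_iff] at *
  intro u hu
  rw [map_sub, sub_apply, hv u hu, hw u hu, sub_zero]

theorem eq_of_inner_self_sub (g : Metric E M) {x : M} {v w : TangentSpace 𝓘(ℝ, E) x}
    (h : g.inner x (v - w) (v - w) = 0) : v = w := by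
  by_contra hne
  exact (g.pos x _ (sub_ne_zero.2 hne)).ne' h

/-- A vector that has the properties of the sharp for the horizontal distribution. -/
theorem sharp_horizontal_eq (g : Metric E M) {x : M} {lam : TangentSpace 𝓘(ℝ, E) x →L[ℝ] ℝ}
    {X : TangentSpace 𝓘(ℝ, E) x}
    (hX : (⟨x, X⟩ : TangentBundle 𝓘(ℝ, E) M) ∈ horizontal (F := F) g pr)
    (hX' : ∀ w : TangentSpace 𝓘(ℝ, E) x,
      (⟨x, w⟩ : TangentBundle 𝓘(ℝ, E) M) ∈ horizontal (F := F) g pr → lam w = g.inner x X w) :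
    sharp (horizontal (F := F) g pr) (fun x v w => g.inner x v w) x lam = X := by
  refine sharp_eq hX hX' fun Y hY hYX => eq_of_inner_self_sub g ?_
  have := hYX _ (horizontal_sub g hY hX)
  exact (DFunLike.congr_fun (map_sub (g.inner x) Y X) (Y - X)).trans (sub_eq_zero.2 this)

/-- The matrix of the metric in the preferred chart at `c`. -/
def metricInChart (g : Metric E M) (c x : M) : E →L[ℝ] E →L[ℝ] ℝ :=
  ContinuousLinearMap.inCoordinates E (fun x : M => TangentSpace 𝓘(ℝ, E) x) (E →L[ℝ] ℝ)
    (fun x : M => TangentSpace 𝓘(ℝ, E) x →L[ℝ] Trivial M ℝ x) c x c x (g.inner x)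

/-- Bundle coordinates are where smoothness of `g` is available; this identifies them with the
pull-back of `g` by the inverse chart, where the sharp map is computed. -/
theorem metricInChart_apply (g : Metric E M) {c : M} {y : E}
    (hy : y ∈ (extChartAt 𝓘(ℝ, E) c).target) (u v : E) :
    metricInChart g c ((extChartAt 𝓘(ℝ, E) c).symm y) u v =
      g.inner ((extChartAt 𝓘(ℝ, E) c).symm y) (chartSymmDeriv c y u) (chartSymmDeriv c y v) := by
  set x := (extChartAt 𝓘(ℝ, E) c).symm y with hx
  have hxs : x ∈ (chartAt E c).source := by
    rw [← extChartAt_source 𝓘(ℝ, E)]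
    exact (extChartAt 𝓘(ℝ, E) c).map_target hy
  have h1 := TangentBundle.symmL_trivializationAt (I := 𝓘(ℝ, E)) hxs
  simp only [modelWithCornersSelf_coe, range_id, mfderivWithin_univ] at h1
  rw [hx, (extChartAt 𝓘(ℝ, E) c).right_inv hy, ← hx] at h1
  have h2 : ∀ w, (trivializationAt E (fun x : M => TangentSpace 𝓘(ℝ, E) x) c).symmL ℝ x w =
    chartSymmDeriv c y w := fun w => DFunLike.congr_fun h1 w
  have h3 : (trivializationAt ℝ (Trivial M ℝ) c).continuousLinearMapAt ℝ x =
    ContinuousLinearMap.id ℝ ℝ := Trivial.continuousLinearMapAt_trivialization ℝ M ℝ x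
  have h4 : x ∈ (trivializationAt (E →L[ℝ] ℝ)
      (fun x : M => TangentSpace 𝓘(ℝ, E) x →L[ℝ] Trivial M ℝ x) c).baseSet := ⟨hxs, mem_univ _⟩
  change (trivializationAt (E →L[ℝ] ℝ) (fun x : M => TangentSpace 𝓘(ℝ, E) x →L[ℝ] Trivial M ℝ x)
    c).continuousLinearMapAt ℝ x (g.inner x
      ((trivializationAt E (fun x : M => TangentSpace 𝓘(ℝ, E) x) c).symmL ℝ x u)) v = _
  rw [h2, Trivialization.continuousLinearMapAt_apply, Trivialization.coe_linearMapAt_of_mem _ h4]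
  change (trivializationAt ℝ (Trivial M ℝ) c).continuousLinearMapAt ℝ x
    (g.inner x (chartSymmDeriv c y u)
      ((trivializationAt E (fun x : M => TangentSpace 𝓘(ℝ, E) x) c).symmL ℝ x v)) = _
  rw [h2, h3]
  rfl

theorem contMDiffAt_metricInChart (g : Metric E M) (c : M) :
    ContMDiffAt 𝓘(ℝ, E) 𝓘(ℝ, E →L[ℝ] E →L[ℝ] ℝ) ∞ (metricInChart g c) c :=
  ((contMDiffAt_hom_bundle _).1 (g.contMDiff c)).2

/-- The chart carries the metric and the kernel of `d pr` to those of the linear model, so the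
horizontal sharp is given there by `orthogonalSharp`. -/
theorem sharp_horizontal_inCharts (g : Metric E M) (hpr : ContMDiff 𝓘(ℝ, E) 𝓘(ℝ, F) ∞ pr)
    (hsurj : ∀ m, Function.Surjective (mfderiv 𝓘(ℝ, E) 𝓘(ℝ, F) pr m)) {c : M} {y : E}
    (hy : y ∈ (extChartAt 𝓘(ℝ, E) c).target)
    (hy' : pr ((extChartAt 𝓘(ℝ, E) c).symm y) ∈ (extChartAt 𝓘(ℝ, F) (pr c)).source)
    (p : E →L[ℝ] ℝ) :
    sharp (horizontal (F := F) g pr) (fun x v w => g.inner x v w) ((extChartAt 𝓘(ℝ, E) c).symm y)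
        (cotCoordSymm c (y, p)).2 =
      chartSymmDeriv c y (orthogonalSharp (metricInChart g c ((extChartAt 𝓘(ℝ, E) c).symm y))
        (fderiv ℝ (inCharts E F pr c) y) p) := by
  set x := (extChartAt 𝓘(ℝ, E) c).symm y with hx
  have hb := chartSymmDeriv_bijective hy
  have hG := metricInChart_apply g hy
  have hpos : ∀ v, v ≠ 0 → 0 < metricInChart g c x v v := by
    intro v hv
    rw [hG]
    exact g.pos x _ fun h => hv (hb.injective (h.trans (map_zero (chartSymmDeriv c y)).symm))
  have hsymm : ∀ v w, metricInChart g c x v w = metricInChart g c x w v := by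
    intro v w
    rw [hG, hG]
    exact g.symm x _ _
  have hker : ∀ v : E, fderiv ℝ (inCharts E F pr c) y v = 0 ↔
      mfderiv 𝓘(ℝ, E) 𝓘(ℝ, F) pr x (chartSymmDeriv c y v) = 0 := by
    intro v
    rw [fderiv_inCharts hpr hy hy']
    exact (map_eq_zero_iff (chartDeriv F (pr c) (pr x)) (chartDeriv_bijective hy').injective)
  refine sharp_horizontal_eq g ?_ ?_
  · intro w hw
    obtain ⟨w, rfl⟩ := hb.surjective w
    refine (hG _ w).symm.trans ?_
    exact orthogonalSharp_orthogonal hpos p ((hker w).2 hw)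
  · intro w hw
    obtain ⟨w, rfl⟩ := hb.surjective w
    have h1 : p w = metricInChart g c x (orthogonalSharp (metricInChart g c x)
        (fderiv ℝ (inCharts E F pr c) y) p) w :=
      orthogonalSharp_spec hpos hsymm (fderiv_inCharts_surjective hpr hsurj hy hy') p
        fun v hv => (hG w v).trans (hw _ ((hker v).1 hv))
    refine Eq.trans ?_ (h1.trans (hG _ w))
    exact congrArg p (DFunLike.congr_fun (chartDeriv_comp_chartSymmDeriv hy) w)

/-- A function on `T*M` is smooth if it is smooth in the induced charts. -/
theorem contMDiff_of_contDiffAt_charts {H : CotangentBundle E M → ℝ}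
    (h : ∀ a : CotangentBundle E M, ContDiffAt ℝ ∞ (H ∘ (extChartAt (cotModel E) a).symm)
      (extChartAt (cotModel E) a a)) : ContMDiff (cotModel E) 𝓘(ℝ, ℝ) ∞ H := by
  intro a
  have h0 : ContMDiffAt (cotModel E) 𝓘(ℝ, E × (E →L[ℝ] ℝ)) ∞ (extChartAt (cotModel E) a) a :=
    contMDiffAt_extChartAt
  have h1 : ContMDiffAt (cotModel E) 𝓘(ℝ, ℝ) ∞
      ((H ∘ (extChartAt (cotModel E) a).symm) ∘ extChartAt (cotModel E) a) a :=
    ContMDiffAt.comp a (g := H ∘ (extChartAt (cotModel E) a).symm) (h a).contMDiffAt h0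
  refine h1.congr_of_eventuallyEq ?_
  filter_upwards [extChartAt_source_mem_nhds (I := cotModel E) a] with p hp
  rw [Function.comp_apply, Function.comp_apply, (extChartAt (cotModel E) a).left_inv hp]

/-- The Hamiltonian of the horizontal distribution of a submersion is smooth. -/
theorem contMDiff_hamiltonian_horizontal (g : Metric E M)
    (hpr : ContMDiff 𝓘(ℝ, E) 𝓘(ℝ, F) ∞ pr)
    (hsurj : ∀ m, Function.Surjective (mfderiv 𝓘(ℝ, E) 𝓘(ℝ, F) pr m)) :
    ContMDiff (cotModel E) 𝓘(ℝ, ℝ) ∞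
      (hamiltonian (horizontal (F := F) g pr) (fun x v w => g.inner x v w)) := by
  refine contMDiff_of_contDiffAt_charts fun a => ?_
  set c := a.proj with hc
  set z₀ := extChartAt (cotModel E) a a with hz₀
  have hz₀1 : z₀.1 = extChartAt 𝓘(ℝ, E) c c :=
    congrArg Prod.fst (extChartAt_cotangent_apply a (mem_extChartAt_source (I := 𝓘(ℝ, E)) c))
  have hev := eventually_mem_charts (E := E) (F := F) hpr.continuous c
  rw [← hz₀1] at hev
  obtain ⟨hzt, hzs⟩ := hev.self_of_nhds
  let G : E → E →L[ℝ] E →L[ℝ] ℝ := fun y => metricInChart g c ((extChartAt 𝓘(ℝ, E) c).symm y)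
  let X : E × (E →L[ℝ] ℝ) → E := fun z =>
    orthogonalSharp (G z.1) (fderiv ℝ (inCharts E F pr c) z.1) z.2
  have hGs : ContDiffAt ℝ ∞ G z₀.1 := by
    have h1 : ContMDiffAt 𝓘(ℝ, E) 𝓘(ℝ, E) ∞ (extChartAt 𝓘(ℝ, E) c).symm z₀.1 :=
      (contMDiffOn_extChartAt_symm (I := 𝓘(ℝ, E)) (n := ∞) c).contMDiffAt
        ((isOpen_extChartAt_target c).mem_nhds hzt)
    have h2 : ContMDiffAt 𝓘(ℝ, E) 𝓘(ℝ, E →L[ℝ] E →L[ℝ] ℝ) ∞ (metricInChart g c)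
        ((extChartAt 𝓘(ℝ, E) c).symm z₀.1) := by
      rw [hz₀1, extChartAt_to_inv]
      exact contMDiffAt_metricInChart g c
    exact (h2.comp z₀.1 h1).contDiffAt
  have hA : ContDiffAt ℝ ∞ (fderiv ℝ (inCharts E F pr c)) z₀.1 :=
    (contDiffAt_inCharts hpr hzt hzs).fderiv_right (m := ∞) (by norm_cast)
  have hpos : ∀ v, v ≠ 0 → 0 < G z₀.1 v v := by
    intro v hv
    refine (g.pos _ _ fun h => hv ?_).trans_eq (metricInChart_apply g hzt v v).symm
    exact (chartSymmDeriv_bijective hzt).injective (h.trans (map_zero (chartSymmDeriv c z₀.1)).symm)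
  have hG' : ContDiffAt ℝ ∞ (fun z : E × (E →L[ℝ] ℝ) => G z.1) z₀ :=
    ContDiffAt.comp z₀ (g := G) hGs contDiffAt_fst
  have hX : ContDiffAt ℝ ∞ X z₀ :=
    contDiffAt_orthogonalSharp hG'
      (ContDiffAt.comp z₀ (g := fderiv ℝ (inCharts E F pr c)) hA contDiffAt_fst) contDiffAt_snd
      hpos (fderiv_inCharts_surjective hpr hsurj hzt hzs)
  have hfin : ContDiffAt ℝ ∞ (fun z => (1 / 2 : ℝ) * G z.1 (X z) (X z)) z₀ :=
    contDiffAt_const.mul ((hG'.clm_apply hX).clm_apply hX)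
  refine hfin.congr_of_eventuallyEq ?_
  have hev' : ∀ᶠ z in 𝓝 z₀, z.1 ∈ (extChartAt 𝓘(ℝ, E) c).target ∧
      pr ((extChartAt 𝓘(ℝ, E) c).symm z.1) ∈ (extChartAt 𝓘(ℝ, F) (pr c)).source :=
    (continuousAt_fst (p := z₀)).eventually hev
  filter_upwards [hev'] with z hz
  rw [Function.comp_apply, extChartAt_cotangent_symm_apply a hz.1]
  have h1 := sharp_horizontal_inCharts g hpr hsurj hz.1 hz.2 z.2
  change 1 / 2 * g.inner _ (sharp _ _ ((extChartAt 𝓘(ℝ, E) c).symm z.1) (cotCoordSymm c z).2)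
    (sharp _ _ ((extChartAt 𝓘(ℝ, E) c).symm z.1) (cotCoordSymm c z).2) = _
  rw [h1]
  exact congrArg (fun r : ℝ => 1 / 2 * r) (metricInChart_apply g hz.1 (X z) (X z)).symm

end HorizontalHamiltonian

/-! ### Fibre isometries and the induced Hamiltonian on the base -/

section FibreIsometries

variable {E : Type*} [NormedAddCommGroup E] [NormedSpace ℝ E] [FiniteDimensional ℝ E]
  {M : Type*} [TopologicalSpace M] [ChartedSpace E M] [IsManifold 𝓘(ℝ, E) ∞ M]
  {F : Type*} [NormedAddCommGroup F] [NormedSpace ℝ F] [FiniteDimensional ℝ F]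
  {N : Type*} [TopologicalSpace N] [ChartedSpace F N] [IsManifold 𝓘(ℝ, F) ∞ N]
  {F' : Type*} [NormedAddCommGroup F'] [NormedSpace ℝ F'] [FiniteDimensional ℝ F']
  {N' : Type*} [TopologicalSpace N'] [ChartedSpace F' N'] [IsManifold 𝓘(ℝ, F') ∞ N']
  {pr : M → N} {pr' : M → N'} {g : Metric E M} {R : M → M}

/-- `R` is a smooth isometric map of `(M, g)` into itself that preserves the fibres of `pr`. -/
structure IsFibreIsometry (g : Metric E M) (pr : M → N) (R : M → M) : Prop where
  contMDiff : ContMDiff 𝓘(ℝ, E) 𝓘(ℝ, E) ∞ R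
  comp : pr ∘ R = pr
  inner : ∀ (m : M) (v w : TangentSpace 𝓘(ℝ, E) m),
    g.inner (R m) (mfderiv 𝓘(ℝ, E) 𝓘(ℝ, E) R m v) (mfderiv 𝓘(ℝ, E) 𝓘(ℝ, E) R m w) = g.inner m v w

/-- An isometric differential is injective, hence surjective, as source and target have the same
finite dimension. -/
theorem IsFibreIsometry.surjective (hR : IsFibreIsometry g pr R) (m : M) :
    Function.Surjective (mfderiv 𝓘(ℝ, E) 𝓘(ℝ, E) R m) := by
  let A : E →ₗ[ℝ] E := (show E →L[ℝ] E from mfderiv 𝓘(ℝ, E) 𝓘(ℝ, E) R m : E →L[ℝ] E)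
  have h : Function.Injective A := by
    rw [injective_iff_map_eq_zero]
    intro v hv
    have hv' : mfderiv 𝓘(ℝ, E) 𝓘(ℝ, E) R m v = 0 := hv
    by_contra hne
    refine (g.pos m v hne).ne' ((hR.inner m v v).symm.trans ?_)
    exact (congrArg (fun w => g.inner (R m) w (mfderiv 𝓘(ℝ, E) 𝓘(ℝ, E) R m v)) hv').trans
      (DFunLike.congr_fun (map_zero (g.inner (R m))) _)
  exact (LinearMap.injective_iff_surjective (f := A)).1 h

theorem IsFibreIsometry.mfderiv_comp (hR : IsFibreIsometry g pr R)
    (hpr : ContMDiff 𝓘(ℝ, E) 𝓘(ℝ, F) ∞ pr) (m : M) (v : TangentSpace 𝓘(ℝ, E) m) :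
    (show F from mfderiv 𝓘(ℝ, E) 𝓘(ℝ, F) pr (R m) (mfderiv 𝓘(ℝ, E) 𝓘(ℝ, E) R m v)) =
      (show F from mfderiv 𝓘(ℝ, E) 𝓘(ℝ, F) pr m v) := by
  have h := _root_.mfderiv_comp m ((hpr (R m)).mdifferentiableAt (by simp))
    ((hR.contMDiff m).mdifferentiableAt (by simp))
  have h' : (show E →L[ℝ] F from mfderiv 𝓘(ℝ, E) 𝓘(ℝ, F) (pr ∘ R) m) =
      (show E →L[ℝ] F from mfderiv 𝓘(ℝ, E) 𝓘(ℝ, F) pr m) :=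
    congrArg (fun f : M → N => (show E →L[ℝ] F from mfderiv 𝓘(ℝ, E) 𝓘(ℝ, F) f m)) hR.comp
  exact (DFunLike.congr_fun h v).symm.trans (DFunLike.congr_fun h' v)

/-- Since `dR` is onto and `d pr ∘ dR = d pr`, every vertical vector at `R m` is the image of a
vertical vector at `m`. -/
theorem IsFibreIsometry.map_horizontal (hR : IsFibreIsometry g pr R)
    (hpr : ContMDiff 𝓘(ℝ, E) 𝓘(ℝ, F) ∞ pr) {m : M} {v : TangentSpace 𝓘(ℝ, E) m}
    (hv : (⟨m, v⟩ : TangentBundle 𝓘(ℝ, E) M) ∈ horizontal (F := F) g pr) :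
    (⟨R m, mfderiv 𝓘(ℝ, E) 𝓘(ℝ, E) R m v⟩ : TangentBundle 𝓘(ℝ, E) M) ∈
      horizontal (F := F) g pr := by
  intro w hw
  obtain ⟨w, rfl⟩ := hR.surjective m w
  exact (hR.inner m v w).trans (hv w ((hR.mfderiv_comp hpr m w).symm.trans hw))

/-- A horizontal vector is determined by its projection. -/
theorem horizontal_ext {m : M} {v w : TangentSpace 𝓘(ℝ, E) m}
    (hv : (⟨m, v⟩ : TangentBundle 𝓘(ℝ, E) M) ∈ horizontal (F := F) g pr)
    (hw : (⟨m, w⟩ : TangentBundle 𝓘(ℝ, E) M) ∈ horizontal (F := F) g pr)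
    (h : mfderiv 𝓘(ℝ, E) 𝓘(ℝ, F) pr m v = mfderiv 𝓘(ℝ, E) 𝓘(ℝ, F) pr m w) : v = w :=
  eq_of_inner_self_sub g (horizontal_sub g hv hw _
    ((map_sub (mfderiv 𝓘(ℝ, E) 𝓘(ℝ, F) pr m) v w).trans (sub_eq_zero.2 h)))

/-- The base metric is defined by a choice of a value common to all points of the fibre. Such a
value exists because horizontal lifts of one vector to different points correspond under the
isometries `R`. -/
theorem baseMetric_eq (hpr : ContMDiff 𝓘(ℝ, E) 𝓘(ℝ, F) ∞ pr)
    (htrans : ∀ m m', pr m = pr m' → ∃ R, IsFibreIsometry g pr R ∧ m' = R m) {m : M}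
    {v w : TangentSpace 𝓘(ℝ, E) m}
    (hv : (⟨m, v⟩ : TangentBundle 𝓘(ℝ, E) M) ∈ horizontal (F := F) g pr)
    (hw : (⟨m, w⟩ : TangentBundle 𝓘(ℝ, E) M) ∈ horizontal (F := F) g pr) :
    baseMetric (F := F) g pr (pr m) (mfderiv 𝓘(ℝ, E) 𝓘(ℝ, F) pr m v)
      (mfderiv 𝓘(ℝ, E) 𝓘(ℝ, F) pr m w) = g.inner m v w := by
  have hlift : ∀ {R : M → M}, IsFibreIsometry g pr R → ∀ {u : TangentSpace 𝓘(ℝ, E) m},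
      (⟨m, u⟩ : TangentBundle 𝓘(ℝ, E) M) ∈ horizontal (F := F) g pr →
      ∀ {u' : TangentSpace 𝓘(ℝ, E) (R m)},
      (⟨R m, u'⟩ : TangentBundle 𝓘(ℝ, E) M) ∈ horizontal (F := F) g pr →
      tangentMap 𝓘(ℝ, E) 𝓘(ℝ, F) pr ⟨R m, u'⟩ =
        (⟨pr m, mfderiv 𝓘(ℝ, E) 𝓘(ℝ, F) pr m u⟩ : TangentBundle 𝓘(ℝ, F) N) →
      u' = mfderiv 𝓘(ℝ, E) 𝓘(ℝ, E) R m u := by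
    intro R hR u hu u' hu' h
    refine horizontal_ext hu' (hR.map_horizontal hpr hu) ?_
    exact (congrArg (fun p : TangentBundle 𝓘(ℝ, F) N => (show F from p.2)) h).trans
      (hR.mfderiv_comp hpr m u).symm
  refine (Classical.epsilon_spec (p := fun r : ℝ => ∀ (m' : M) (v' w' : TangentSpace 𝓘(ℝ, E) m'),
    (⟨m', v'⟩ : TangentBundle 𝓘(ℝ, E) M) ∈ horizontal (F := F) g pr →
    (⟨m', w'⟩ : TangentBundle 𝓘(ℝ, E) M) ∈ horizontal (F := F) g pr →
    tangentMap 𝓘(ℝ, E) 𝓘(ℝ, F) pr ⟨m', v'⟩ =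
      (⟨pr m, mfderiv 𝓘(ℝ, E) 𝓘(ℝ, F) pr m v⟩ : TangentBundle 𝓘(ℝ, F) N) →
    tangentMap 𝓘(ℝ, E) 𝓘(ℝ, F) pr ⟨m', w'⟩ =
      (⟨pr m, mfderiv 𝓘(ℝ, E) 𝓘(ℝ, F) pr m w⟩ : TangentBundle 𝓘(ℝ, F) N) →
    g.inner m' v' w' = r) ⟨g.inner m v w, ?_⟩ m v w hv hw rfl rfl).symm
  intro m' v' w' hv' hw' h1 h2
  obtain ⟨R, hR, rfl⟩ := htrans m m' (congrArg TotalSpace.proj h1).symm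
  obtain rfl := hlift hR hv hv' h1
  obtain rfl := hlift hR hw hw' h2
  exact hR.inner m v w

/-- A vector of the pushed distribution has a lift at some point of the fibre. An isometry that
respects both projections moves that lift to `m` and keeps it `pr'`-horizontal. -/
theorem exists_mem_of_mem_pushDistribution (hpr : ContMDiff 𝓘(ℝ, E) 𝓘(ℝ, F) ∞ pr)
    (hpr' : ContMDiff 𝓘(ℝ, E) 𝓘(ℝ, F') ∞ pr')
    (htrans : ∀ m m', pr m = pr m' →
      ∃ R, IsFibreIsometry g pr R ∧ IsFibreIsometry g pr' R ∧ m' = R m) {m : M}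
    {w' : TangentSpace 𝓘(ℝ, F) (pr m)} (hw' : (⟨pr m, w'⟩ : TangentBundle 𝓘(ℝ, F) N) ∈
      pushDistribution (F := F) pr (horizontal (F := F') g pr')) :
    ∃ w : TangentSpace 𝓘(ℝ, E) m,
      (⟨m, w⟩ : TangentBundle 𝓘(ℝ, E) M) ∈ horizontal (F := F') g pr' ∧
      mfderiv 𝓘(ℝ, E) 𝓘(ℝ, F) pr m w = w' := by
  obtain ⟨⟨m', u⟩, hu, h⟩ := hw'
  obtain ⟨R, hR, hR', rfl⟩ := htrans m' m (congrArg TotalSpace.proj h)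
  refine ⟨mfderiv 𝓘(ℝ, E) 𝓘(ℝ, E) R m' u, hR'.map_horizontal hpr' hu, ?_⟩
  exact (hR.mfderiv_comp hpr m' u).trans
    (congrArg (fun p : TangentBundle 𝓘(ℝ, F) N => (show F from p.2)) h)

theorem exists_sharp_horizontal (hsurj : ∀ m, Function.Surjective (mfderiv 𝓘(ℝ, E) 𝓘(ℝ, F) pr m))
    (m : M) (lam : TangentSpace 𝓘(ℝ, E) m →L[ℝ] ℝ) : ∃ X : TangentSpace 𝓘(ℝ, E) m,
      (⟨m, X⟩ : TangentBundle 𝓘(ℝ, E) M) ∈ horizontal (F := F) g pr ∧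
      ∀ w : TangentSpace 𝓘(ℝ, E) m,
        (⟨m, w⟩ : TangentBundle 𝓘(ℝ, E) M) ∈ horizontal (F := F) g pr → lam w = g.inner m X w := by
  let G : E →L[ℝ] E →L[ℝ] ℝ := g.inner m
  let A : E →L[ℝ] F := mfderiv 𝓘(ℝ, E) 𝓘(ℝ, F) pr m
  let l : E →L[ℝ] ℝ := lam
  have hpos : ∀ v, v ≠ 0 → 0 < G v v := g.pos m
  have hA : Function.Surjective A := hsurj m
  let X : E := orthogonalSharp G A l
  have hX : ∀ w : E, A w = 0 → G X w = 0 := fun w hw => orthogonalSharp_orthogonal hpos l hw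
  have hX' : ∀ w : E, (∀ v : E, A v = 0 → G w v = 0) → l w = G X w := fun w hw =>
    orthogonalSharp_spec hpos (g.symm m) hA l hw
  exact ⟨X, hX, hX'⟩

/-- The Hamiltonian of `ker dpr'^⊥` at a covector that is pulled back from the base of `pr` is the
Hamiltonian of the image of this distribution in the base. -/
theorem hamiltonian_cotangentPullback (hpr : ContMDiff 𝓘(ℝ, E) 𝓘(ℝ, F) ∞ pr)
    (hpr' : ContMDiff 𝓘(ℝ, E) 𝓘(ℝ, F') ∞ pr')
    (hsurj' : ∀ m, Function.Surjective (mfderiv 𝓘(ℝ, E) 𝓘(ℝ, F') pr' m))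
    (hker : ∀ (m : M) (v : TangentSpace 𝓘(ℝ, E) m),
      mfderiv 𝓘(ℝ, E) 𝓘(ℝ, F) pr m v = 0 → mfderiv 𝓘(ℝ, E) 𝓘(ℝ, F') pr' m v = 0)
    (htrans : ∀ m m', pr m = pr m' →
      ∃ R, IsFibreIsometry g pr R ∧ IsFibreIsometry g pr' R ∧ m' = R m)
    (m : M) (μ : TangentSpace 𝓘(ℝ, F) (pr m) →L[ℝ] ℝ) :
    hamiltonian (horizontal (F := F') g pr') (fun x v w => g.inner x v w)
        (cotangentPullback pr m μ) =
      hamiltonian (pushDistribution (F := F) pr (horizontal (F := F') g pr'))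
        (baseMetric (F := F) g pr) ⟨pr m, μ⟩ := by
  obtain ⟨X, hX, hX'⟩ := exists_sharp_horizontal (g := g) hsurj' m
    (μ.comp (mfderiv 𝓘(ℝ, E) 𝓘(ℝ, F) pr m))
  -- A larger vertical space has a smaller orthogonal complement; this is `D_H ⊂ D_K`.
  have hsub : ∀ {v : TangentSpace 𝓘(ℝ, E) m},
      (⟨m, v⟩ : TangentBundle 𝓘(ℝ, E) M) ∈ horizontal (F := F') g pr' →
      (⟨m, v⟩ : TangentBundle 𝓘(ℝ, E) M) ∈ horizontal (F := F) g pr :=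
    fun hv w hw => hv w (hker m w hw)
  have hbase : ∀ {v w : TangentSpace 𝓘(ℝ, E) m},
      (⟨m, v⟩ : TangentBundle 𝓘(ℝ, E) M) ∈ horizontal (F := F') g pr' →
      (⟨m, w⟩ : TangentBundle 𝓘(ℝ, E) M) ∈ horizontal (F := F') g pr' →
      baseMetric (F := F) g pr (pr m) (mfderiv 𝓘(ℝ, E) 𝓘(ℝ, F) pr m v)
        (mfderiv 𝓘(ℝ, E) 𝓘(ℝ, F) pr m w) = g.inner m v w := fun hv hw =>
    baseMetric_eq hpr (fun a b hab => (htrans a b hab).imp fun R hR => ⟨hR.1, hR.2.2⟩)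
      (hsub hv) (hsub hw)
  have h1 : sharp (horizontal (F := F') g pr') (fun x v w => g.inner x v w) m
      (μ.comp (mfderiv 𝓘(ℝ, E) 𝓘(ℝ, F) pr m)) = X := sharp_horizontal_eq g hX hX'
  have h2 : sharp (pushDistribution (F := F) pr (horizontal (F := F') g pr'))
      (baseMetric (F := F) g pr) (pr m) μ = mfderiv 𝓘(ℝ, E) 𝓘(ℝ, F) pr m X := by
    refine sharp_eq ⟨⟨m, X⟩, hX, rfl⟩ ?_ ?_
    · intro w' hw'
      obtain ⟨w, hw, rfl⟩ := exists_mem_of_mem_pushDistribution hpr hpr' htrans hw'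
      exact (hX' w hw).trans (hbase hX hw).symm
    -- Uniqueness of the sharp on the base: after lifting `Y'` to `Y`, positivity of `g` is applied
    -- to the horizontal vector `Y - X`.
    · intro Y' hY' hYX
      obtain ⟨Y, hY, rfl⟩ := exists_mem_of_mem_pushDistribution hpr hpr' htrans hY'
      have hmem := horizontal_sub g hY hX
      have h3 := hYX _ ⟨⟨m, Y - X⟩, hmem, rfl⟩
      have h4 : g.inner m Y (Y - X) = g.inner m X (Y - X) :=
        (hbase hY hmem).symm.trans (h3.trans (hbase hX hmem))
      have h5 : Y = X := eq_of_inner_self_sub g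
        ((DFunLike.congr_fun (map_sub (g.inner m) Y X) (Y - X)).trans (sub_eq_zero.2 h4))
      rw [h5]
  change 1 / 2 * g.inner m (sharp _ _ m (μ.comp (mfderiv 𝓘(ℝ, E) 𝓘(ℝ, F) pr m)))
    (sharp _ _ m (μ.comp (mfderiv 𝓘(ℝ, E) 𝓘(ℝ, F) pr m))) =
    1 / 2 * baseMetric (F := F) g pr (pr m) (sharp _ _ (pr m) μ) (sharp _ _ (pr m) μ)
  rw [h1, h2, hbase hX hX]

end FibreIsometries

/-! ### Descent of smoothness to the base -/

section Descent

variable {E : Type*} [NormedAddCommGroup E] [NormedSpace ℝ E] [FiniteDimensional ℝ E]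
  {M : Type*} [TopologicalSpace M] [ChartedSpace E M] [IsManifold 𝓘(ℝ, E) ∞ M]
  {F : Type*} [NormedAddCommGroup F] [NormedSpace ℝ F] [FiniteDimensional ℝ F]
  {N : Type*} [TopologicalSpace N] [ChartedSpace F N] [IsManifold 𝓘(ℝ, F) ∞ N]
  {pr : M → N}

/-- A function on `T*N` whose pull-back along a surjective submersion is smooth is smooth. -/
theorem contMDiff_of_cotangentPullback (hpr : Manifold.IsSubmersion 𝓘(ℝ, E) 𝓘(ℝ, F) ∞ pr)
    (hsurj : Function.Surjective pr) {H : CotangentBundle E M → ℝ} {k : CotangentBundle F N → ℝ}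
    (hH : ContMDiff (cotModel E) 𝓘(ℝ, ℝ) ∞ H)
    (hrel : ∀ (m : M) (μ : TangentSpace 𝓘(ℝ, F) (pr m) →L[ℝ] ℝ),
      H (cotangentPullback pr m μ) = k ⟨pr m, μ⟩) : ContMDiff (cotModel F) 𝓘(ℝ, ℝ) ∞ k := by
  refine contMDiff_of_contDiffAt_charts fun b => ?_
  obtain ⟨m, hm⟩ := hsurj b.proj
  obtain ⟨s, hs, hsm, hps⟩ := exists_localSection hpr m
  -- The zero covector only selects a chart of `T*M` over `m`.
  let a : CotangentBundle E M := ⟨m, 0⟩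
  set f := inCharts E F pr m with hf
  set z₀ := extChartAt (cotModel F) b b with hz₀
  have hz₀1 : z₀.1 = extChartAt 𝓘(ℝ, F) (pr m) (pr m) := by
    refine (congrArg Prod.fst (extChartAt_cotangent_apply b
      (mem_extChartAt_source (I := 𝓘(ℝ, F)) b.proj))).trans ?_
    exact congrArg (fun n => extChartAt 𝓘(ℝ, F) n n) hm.symm
  set y₀ := extChartAt 𝓘(ℝ, F) (pr m) (pr m) with hy₀
  set x₀ := extChartAt 𝓘(ℝ, E) m m with hx₀
  let σ : F → E := extChartAt 𝓘(ℝ, E) m ∘ s ∘ (extChartAt 𝓘(ℝ, F) (pr m)).symm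
  have hσ0 : σ y₀ = x₀ := by
    change extChartAt 𝓘(ℝ, E) m (s ((extChartAt 𝓘(ℝ, F) (pr m)).symm y₀)) = x₀
    rw [hy₀, extChartAt_to_inv, hsm]
  have hσ : ContDiffAt ℝ ∞ σ y₀ := by
    have h1 : ContMDiffAt 𝓘(ℝ, F) 𝓘(ℝ, F) ∞ (extChartAt 𝓘(ℝ, F) (pr m)).symm y₀ :=
      (contMDiffOn_extChartAt_symm (I := 𝓘(ℝ, F)) (n := ∞) (pr m)).contMDiffAt
        (extChartAt_target_mem_nhds (pr m))
    have h2 : ContMDiffAt 𝓘(ℝ, F) 𝓘(ℝ, E) ∞ s ((extChartAt 𝓘(ℝ, F) (pr m)).symm y₀) := by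
      rwa [hy₀, extChartAt_to_inv]
    have h3 : ContMDiffAt 𝓘(ℝ, E) 𝓘(ℝ, E) ∞ (extChartAt 𝓘(ℝ, E) m)
        ((s ∘ (extChartAt 𝓘(ℝ, F) (pr m)).symm) y₀) := by
      rw [Function.comp_apply, hy₀, extChartAt_to_inv, hsm]
      exact contMDiffAt_extChartAt
    exact (h3.comp y₀ (h2.comp y₀ h1)).contDiffAt
  have hev := eventually_mem_charts (E := E) (F := F) hpr.contMDiff.continuous m
  have hev' : ∀ᶠ y in 𝓝 y₀, σ y ∈ (extChartAt 𝓘(ℝ, E) m).target ∧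
      pr ((extChartAt 𝓘(ℝ, E) m).symm (σ y)) ∈ (extChartAt 𝓘(ℝ, F) (pr m)).source :=
    hσ.continuousAt.eventually (by rwa [hσ0])
  have hfσ : ∀ᶠ y in 𝓝 y₀, f (σ y) = y := by
    have hc : ContinuousAt (extChartAt 𝓘(ℝ, F) (pr m)).symm y₀ := continuousAt_extChartAt_symm _
    have hc' : ContinuousAt (s ∘ (extChartAt 𝓘(ℝ, F) (pr m)).symm) y₀ := by
      refine ContinuousAt.comp ?_ hc
      rw [hy₀, extChartAt_to_inv]
      exact hs.continuousAt
    have e1 : ∀ᶠ y in 𝓝 y₀, pr (s ((extChartAt 𝓘(ℝ, F) (pr m)).symm y)) =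
        (extChartAt 𝓘(ℝ, F) (pr m)).symm y :=
      hc.eventually (by rwa [hy₀, extChartAt_to_inv])
    have e2 : ∀ᶠ y in 𝓝 y₀, s ((extChartAt 𝓘(ℝ, F) (pr m)).symm y) ∈
        (extChartAt 𝓘(ℝ, E) m).source := by
      refine hc'.eventually ((isOpen_extChartAt_source m).mem_nhds ?_)
      rw [Function.comp_apply, hy₀, extChartAt_to_inv, hsm]
      exact mem_extChartAt_source m
    filter_upwards [e1, e2, extChartAt_target_mem_nhds (I := 𝓘(ℝ, F)) (pr m)] with y h1 h2 h3
    change extChartAt 𝓘(ℝ, F) (pr m) (pr ((extChartAt 𝓘(ℝ, E) m).symm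
      (extChartAt 𝓘(ℝ, E) m (s ((extChartAt 𝓘(ℝ, F) (pr m)).symm y))))) = y
    rw [(extChartAt 𝓘(ℝ, E) m).left_inv h2, h1, (extChartAt 𝓘(ℝ, F) (pr m)).right_inv h3]
  obtain ⟨hx₀t, hx₀s⟩ := hev.self_of_nhds
  have hDf : ContDiffAt ℝ ∞ (fun y => fderiv ℝ f (σ y)) y₀ := by
    have h1 : ContDiffAt ℝ ∞ (fderiv ℝ f) (σ y₀) := by
      rw [hσ0]
      exact (contDiffAt_inCharts hpr.contMDiff hx₀t hx₀s).fderiv_right (m := ∞) (by norm_cast)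
    exact ContDiffAt.comp y₀ h1 hσ
  -- The pull-back of covectors along the local section `σ`, in coordinates. As `f ∘ σ` is the
  -- identity near `y₀`, the function `k` reads as `H ∘ T` in charts.
  let T : F × (F →L[ℝ] ℝ) → E × (E →L[ℝ] ℝ) := fun z => (σ z.1, z.2.comp (fderiv ℝ f (σ z.1)))
  have hT : ContDiffAt ℝ ∞ T z₀ := by
    refine ContDiffAt.prodMk (ContDiffAt.comp z₀ (g := σ) (by rwa [hz₀1]) contDiffAt_fst) ?_
    exact contDiffAt_snd.clm_comp
      (ContDiffAt.comp z₀ (g := fun y => fderiv ℝ f (σ y)) (by rwa [hz₀1]) contDiffAt_fst)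
  have hh : ContDiffAt ℝ ∞ (H ∘ (extChartAt (cotModel E) a).symm) (T z₀) := by
    have hz : T z₀ ∈ (extChartAt (cotModel E) a).target :=
      mem_target_of_fst_mem (by
        change σ z₀.1 ∈ _
        rw [hz₀1, hσ0]
        exact hx₀t)
    have h1 := (contMDiffOn_extChartAt_symm (I := cotModel E) (n := ∞) a).contMDiffAt
      ((isOpen_extChartAt_target a).mem_nhds hz)
    exact (ContMDiffAt.comp (T z₀) (hH _) h1).contDiffAt
  refine (ContDiffAt.comp z₀ hh hT).congr_of_eventuallyEq ?_
  have hfst : ContinuousAt (Prod.fst : F × (F →L[ℝ] ℝ) → F) z₀ := continuousAt_fst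
  have h1 : ∀ᶠ y in 𝓝 z₀.1, σ y ∈ (extChartAt 𝓘(ℝ, E) m).target ∧
      pr ((extChartAt 𝓘(ℝ, E) m).symm (σ y)) ∈ (extChartAt 𝓘(ℝ, F) (pr m)).source := by
    rwa [hz₀1]
  have h2 : ∀ᶠ y in 𝓝 z₀.1, f (σ y) = y := by rwa [hz₀1]
  filter_upwards [hfst.eventually h1, hfst.eventually h2] with z h3 h4
  have h5 := extChartAt_symm_inCharts (b := b) hm.symm h3.2 z.2
  have h6 := extChartAt_symm_pullback (a := a) hpr.contMDiff h3.1 h3.2 z.2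
  have h7 : z = (f (σ z.1), z.2) := Prod.ext h4.symm rfl
  refine (congrArg (fun z => k ((extChartAt (cotModel F) b).symm z)) h7).trans ?_
  exact (congrArg k h5).trans ((hrel _ _).symm.trans (congrArg H h6).symm)

end Descent

end SubRiem

end

/-! ### The theorem for principal bundles -/

theorem theorem1
    {E : Type*} [NormedAddCommGroup E] [NormedSpace ℝ E] [FiniteDimensional ℝ E]
    {M : Type*} [TopologicalSpace M] [ChartedSpace E M] [IsManifold 𝓘(ℝ, E) ∞ M]
    [T2Space M] [SecondCountableTopology M] [ConnectedSpace M]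
    {L : Type*} [NormedAddCommGroup L] [NormedSpace ℝ L] [FiniteDimensional ℝ L]
    {H : Type*} [Group H] [TopologicalSpace H] [ChartedSpace L H] [LieGroup 𝓘(ℝ, L) ∞ H]
    [T2Space H] [SecondCountableTopology H] [ConnectedSpace H]
    [MulAction (MulOpposite H) M]
    (hact : ContMDiff (𝓘(ℝ, E).prod 𝓘(ℝ, L)) 𝓘(ℝ, E) ∞
      (fun p : M × H => SubRiem.ract p.1 p.2))
    (K : Subgroup H) (hKclosed : IsClosed (K : Set H)) (hKconn : IsConnected (K : Set H))
    {FH : Type*} [NormedAddCommGroup FH] [NormedSpace ℝ FH] [FiniteDimensional ℝ FH]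
    {NH : Type*} [TopologicalSpace NH] [ChartedSpace FH NH] [IsManifold 𝓘(ℝ, FH) ∞ NH]
    [T2Space NH] [SecondCountableTopology NH]
    {FK : Type*} [NormedAddCommGroup FK] [NormedSpace ℝ FK] [FiniteDimensional ℝ FK]
    {NK : Type*} [TopologicalSpace NK] [ChartedSpace FK NK] [IsManifold 𝓘(ℝ, FK) ∞ NK]
    [T2Space NK] [SecondCountableTopology NK]
    (πH : M → NH) (πK : M → NK)
    (hπH : SubRiem.IsPrincipalBundle E FH (⊤ : Subgroup H) πH)
    (hπK : SubRiem.IsPrincipalBundle E FK K πK)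
    (g : SubRiem.Metric E M) (hg : SubRiem.IsConstantBiInvariantType L H g)
    (m : M) (μ : TangentSpace 𝓘(ℝ, FK) (πK m) →L[ℝ] ℝ)
    (hsymp : SubRiem.PullbackIsSymplecticNear E πK
      (⟨πK m, μ⟩ : SubRiem.CotangentBundle FK NK)) :
    let DH := SubRiem.horizontal (F := FH) g πH
    let gDH := fun x (v w : TangentSpace 𝓘(ℝ, E) x) => g.inner x v w
    let D := SubRiem.pushDistribution (F := FK) πK DH
    let gD := SubRiem.baseMetric (F := FK) g πK
    let p := SubRiem.cotangentPullback πK m μ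
    let q : SubRiem.CotangentBundle FK NK := ⟨πK m, μ⟩
    (∃ ε > 0, ∃ γ : ℝ → M, SubRiem.IsSRGeodesicOn DH gDH p γ (Ioo (-ε) ε)) ∧
    ∀ J : Set ℝ, IsOpen J → J.OrdConnected → (0 : ℝ) ∈ J →
      ∀ γ : ℝ → M, SubRiem.IsSRGeodesicOn DH gDH p γ J →
        SubRiem.IsSRGeodesicOn D gD q (fun t => πK (γ t)) J ∧
        ∀ γ' : ℝ → NK, SubRiem.IsSRGeodesicOn D gD q γ' J → ∀ t ∈ J, πK (γ t) = γ' t := by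
  have hsH := SubRiem.mfderiv_surjective_of_isSubmersion hπH.isSubmersion
  have hsK := SubRiem.mfderiv_surjective_of_isSubmersion hπK.isSubmersion
  have hcH := hπH.isSubmersion.contMDiff
  have hcK := hπK.isSubmersion.contMDiff
  have hfibre : ∀ a b, πK a = πK b → πH a = πH b := fun a b hab =>
    have ⟨k, _, hk⟩ := (hπK.fibre a b).1 hab
    (hπH.fibre a b).2 ⟨k, trivial, hk⟩
  have hker : ∀ (x : M) (v : TangentSpace 𝓘(ℝ, E) x),
      mfderiv 𝓘(ℝ, E) 𝓘(ℝ, FK) πK x v = 0 → mfderiv 𝓘(ℝ, E) 𝓘(ℝ, FH) πH x v = 0 :=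
    fun x v hv => SubRiem.mfderiv_eq_zero_of_fibre hπK.isSubmersion hcH hfibre hv
  -- Points of one `K`-fibre differ by the action of some `k ∈ K`, which is an isometry by
  -- invariance of `g` and preserves the fibres of both projections.
  have htrans : ∀ a b, πK a = πK b →
      ∃ R, SubRiem.IsFibreIsometry g πK R ∧ SubRiem.IsFibreIsometry g πH R ∧ b = R a := by
    intro a b hab
    obtain ⟨k, hk, hb⟩ := (hπK.fibre a b).1 hab
    have hR : ContMDiff 𝓘(ℝ, E) 𝓘(ℝ, E) ∞ (fun x : M => SubRiem.ract x k) :=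
      hact.comp (contMDiff_id.prodMk contMDiff_const)
    exact ⟨fun x => SubRiem.ract x k,
      ⟨hR, funext fun x => ((hπK.fibre x _).2 ⟨k, hk, rfl⟩).symm, hg.invariant k⟩,
      ⟨hR, funext fun x => ((hπH.fibre x _).2 ⟨k, trivial, rfl⟩).symm, hg.invariant k⟩, hb⟩
  have hrel := SubRiem.hamiltonian_cotangentPullback hcK hcH hsH hker htrans
  have hH := SubRiem.contMDiff_hamiltonian_horizontal g hcH hsH
  exact SubRiem.isSRGeodesicOn_proj hcK hsK hH
    (SubRiem.contMDiff_of_cotangentPullback hπK.isSubmersion hπK.surjective hH hrel) hrel m μ
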